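/- **Setting.** Let $d\ge 1$, $T>0$, and let $\Omega\subset\mathbb{R}^d$ be a bounded Lipschitz domain (open, connected, nonempty, and near each boundary point, after a rotation, the region strictly below the graph of a Lipschitz function). Put $\Omega_T=\Omega\times[0,T]$, and let $|\partial\Omega|$ and $ds$ denote the $(d-1)$-dimensional surface measure of $\partial\Omega$. Let $C_{pw}>0$ be a constant of the Poincaré–Wirtinger inequality on $\Omega$, that is, any constant with $$\Bigl\|v-\tfrac1{|\Omega|}\int_\Omega v\,dx\Bigr\|_{L^2(\Omega)}\le C_{pw}\|\nabla v\|_{L^2(\Omega)}\qquad\text{for all }v\in H^1(\Omega).$$ Assume: * (A1) $a:\overline\Omega\to\mathbb{R}$ satisfies $a\ge 0$ and $a\ne0$ almost everywhere in $\overline\Omega$, and $1/a\in L^p(\Omega)$ for some $0<p<\infty$. * (A2) $f:\overline\Omega\times\mathbb{R}\to\mathbb{R}$ is of class $C^{k-1}$ with $k\in\mathbb{N}$, $k>3$, and there are $c>0$ and $r\ge1$ such that, for all $i+j\le k-1$, every partial derivative $D^i$ of order $i$ in $x$, all $x\in\overline\Omega$ and all $s\in\mathbb{R}$, $|D^i\partial_s^jf(x,s)|\le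 c|s|^{(r+1-j)^+}$ (with $0^0=1$). Moreover $r<\frac{d+2}{d-2}$ if $2<d\le4$, and $r<2$ if $d=5$. Let $u\in C^2(\overline\Omega\times[0,T])$ be a classical solution of $$u_{tt}-\Delta u+a(x)u_t+f(x,u)=0\ \text{ in }\Omega_T,\qquad u(\cdot,0)=u_0,\ \ u_t(\cdot,0)=u_1\ \text{ on }\Omega,\qquad u=0\ \text{ on }\partial\Omega\times[0,T].$$ Let $\sigma:\mathbb{R}\to\mathbb{R}$ be a twice differentiable activation function and let $u_\theta:\mathbb{R}^{d+1}\to\mathbb{R}$ be the realization of a feed-forward neural network in the variable $(x,t)$: a composition of at most $L$ affine maps, with $\sigma$ applied componentwise after each of them except the last, all widths in $\{1,\dots,W\}$ and all weights and biases in $[-R,R]$, where $R\in(0,\infty]$. Assume $u_\theta\in C^2(\overline\Omega\times[0,T])$ (which is automatic if $\sigma\in C^2$). Define the residuals $$\mathcal{R}_{PDE}=u_{\theta,tt}-\Delta u_\theta+a\,u_{\theta,t}+f(x,u_\theta)\ \text{ on }\Omega_T,\qquad \mathcal{R}_{s,u_t}=u_{\theta,t}\ \text{ on }\partial\Omega\times[0,T],$$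 $$\mathcal{R}_{u_0}=u_\theta(\cdot,0)-u_0,\qquad \mathcal{R}_{u_1}=u_{\theta,t}(\cdot,0)-u_1,\qquad \mathcal{R}_{\nabla u}=\nabla u_\theta(\cdot,0)-\nabla u_0\ \text{ on }\Omega.$$ For $w:\Omega_T\to\mathbb{R}$ let $\|w\|_{C^0}=\sup_{\Omega_T}|w|$ and $\|w\|_{C^1}=\max\bigl\{\|w\|_{C^0},\ \sup_{\Omega_T}(|\nabla w|^2+w_t^2)^{1/2}\bigr\}$, and set $$\hat C=2^{r-1}c\Bigl(\|u\|_{C^0}^r+\tfrac1{r+1}\|u_\theta-u\|_{C^0}^r\Bigr).$$ **Theorem.** Under these assumptions, $$\int_{\Omega_T}|u_\theta-u|^2\,dx\,dt+\int_{\Omega_T}|u_{\theta,t}-u_t|^2\,dx\,dt\le\mathcal{C}\,T\exp\Bigl(T\max\{1,2C_{pw}^2\}\bigl(1+\hat C+\tfrac{2\sqrt T}{C_{pw}^2}\bigr)\Bigr),$$ where $$\mathcal{C}=\max\{1,2C_{pw}^2\}\Bigl(\|\mathcal{R}_{u_1}\|_{L^2(\Omega)}^2+\|\mathcal{R}_{PDE}\|_{L^2(\Omega_T)}^2+\|\mathcal{R}_{\nabla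 u}\|_{L^2(\Omega)}^2+2\sqrt{T|\partial\Omega|}\,\|u_\theta-u\|_{C^1}\|\mathcal{R}_{s,u_t}\|_{L^2(\partial\Omega\times[0,T])}+\tfrac{2}{C_{pw}^2}\|\mathcal{R}_{u_0}\|_{L^2(\Omega)}^2\Bigr).$$ The $L^2$ norms take values in $[0,\infty]$; if $\mathcal{R}_{PDE}\notin L^2(\Omega_T)$, the right-hand side is $\infty$. -/

import Mathlib

open Set MeasureTheory
open scoped ENNReal NNReal

namespace WavePINN

/-! ### Domains -/

/-- A Lipschitz domain in a Euclidean space: a nonempty connected open set which, near each of its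
boundary points, is after a rotation the region strictly below the graph of a Lipschitz function.
The unit vector `ν` is the vertical direction; `y - ⟪ν, y⟫ ν` is the horizontal part of `y`. -/
def IsLipschitzDomain {d : ℕ} (Ω : Set (EuclideanSpace ℝ (Fin d))) : Prop :=
  IsOpen Ω ∧ IsConnected Ω ∧
    ∀ x ∈ frontier Ω, ∃ ν : EuclideanSpace ℝ (Fin d), ‖ν‖ = 1 ∧
      ∃ (K : ℝ≥0) (γ : EuclideanSpace ℝ (Fin d) → ℝ), LipschitzWith K γ ∧
        ∃ ε > (0 : ℝ), ∀ y ∈ Metric.ball x ε,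
          (y ∈ Ω ↔ inner ℝ ν y < γ (y - (inner ℝ ν y : ℝ) • ν))

/-- The space-time cylinder `Ω × [0,T]`. -/
def cylinder {d : ℕ} (Ω : Set (EuclideanSpace ℝ (Fin d))) (T : ℝ) :
    Set (EuclideanSpace ℝ (Fin d) × ℝ) :=
  Ω ×ˢ Icc 0 T

/-- The surface measure of the boundary of `Ω`: the `(d-1)`-dimensional Hausdorff measure
(normalised so that it agrees with Lebesgue measure on hyperplanes) restricted to `∂Ω`. -/
noncomputable def surfaceMeasure {d : ℕ} (Ω : Set (EuclideanSpace ℝ (Fin d))) :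
    Measure (EuclideanSpace ℝ (Fin d)) :=
  (Measure.euclideanHausdorffMeasure (d - 1)).restrict (frontier Ω)

/-! ### The constant of the Poincaré–Wirtinger inequality -/

/-- `v ∈ H¹(Ω) = W^{1,2}(Ω)` with weak gradient `g`. -/
def IsH1WithGradient {d : ℕ} (Ω : Set (EuclideanSpace ℝ (Fin d)))
    (v : EuclideanSpace ℝ (Fin d) → ℝ)
    (g : EuclideanSpace ℝ (Fin d) → EuclideanSpace ℝ (Fin d)) : Prop :=
  MemLp v 2 (volume.restrict Ω) ∧ MemLp g 2 (volume.restrict Ω) ∧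
    ∀ φ : EuclideanSpace ℝ (Fin d) → ℝ, ContDiff ℝ (⊤ : ℕ∞) φ → HasCompactSupport φ →
      tsupport φ ⊆ Ω →
        ∀ i : Fin d, ∫ x in Ω, v x * (gradient φ x) i = - ∫ x in Ω, g x i * φ x

/-- `C > 0` is a constant for which the (`L²`) Poincaré–Wirtinger inequality
`‖v - v_Ω‖_{L²(Ω)} ≤ C ‖∇v‖_{L²(Ω)}` holds for all `v ∈ H¹(Ω)`, where `v_Ω` is the mean of `v`. -/
def IsPoincareWirtingerConst {d : ℕ} (Ω : Set (EuclideanSpace ℝ (Fin d))) (C : ℝ) : Prop :=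
  0 < C ∧ ∀ (v : EuclideanSpace ℝ (Fin d) → ℝ)
      (g : EuclideanSpace ℝ (Fin d) → EuclideanSpace ℝ (Fin d)), IsH1WithGradient Ω v g →
    eLpNorm (fun x => v x - ⨍ y in Ω, v y) 2 (volume.restrict Ω) ≤
      ENNReal.ofReal C * eLpNorm g 2 (volume.restrict Ω)

/-! ### Derivatives and norms of functions of `(x,t)` -/

/-- `v_t(x,t)`, one-sided at `t = 0` and `t = T`. -/
noncomputable def timeDeriv {d : ℕ} (T : ℝ) (v : EuclideanSpace ℝ (Fin d) × ℝ → ℝ) :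
    EuclideanSpace ℝ (Fin d) × ℝ → ℝ :=
  fun z => derivWithin (fun s => v (z.1, s)) (Icc 0 T) z.2

/-- `∇v(x,t)`, the gradient with respect to `x`. -/
noncomputable def spaceGrad {d : ℕ} (v : EuclideanSpace ℝ (Fin d) × ℝ → ℝ) :
    EuclideanSpace ℝ (Fin d) × ℝ → EuclideanSpace ℝ (Fin d) :=
  fun z => gradient (fun y => v (y, z.2)) z.1

/-- `Δv(x,t)`, the Laplacian with respect to `x`. -/
noncomputable def spaceLaplacian {d : ℕ} (v : EuclideanSpace ℝ (Fin d) × ℝ → ℝ) :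
    EuclideanSpace ℝ (Fin d) × ℝ → ℝ :=
  fun z => Laplacian.laplacian (fun y => v (y, z.2)) z.1

/-- `‖w‖_{C⁰}`, the supremum of `|w|` on `Ω × [0,T]`. -/
noncomputable def normC0 {d : ℕ} (Ω : Set (EuclideanSpace ℝ (Fin d))) (T : ℝ)
    (w : EuclideanSpace ℝ (Fin d) × ℝ → ℝ) : ℝ :=
  ⨆ z : cylinder Ω T, |w z|

/-- `‖w‖_{C¹}`, the maximum of the suprema on `Ω × [0,T]` of `|w|` and of the Euclidean length of
the space-time gradient `(∇w, w_t)`. -/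
noncomputable def normC1 {d : ℕ} (Ω : Set (EuclideanSpace ℝ (Fin d))) (T : ℝ)
    (w : EuclideanSpace ℝ (Fin d) × ℝ → ℝ) : ℝ :=
  max (normC0 Ω T w)
    (⨆ z : cylinder Ω T, Real.sqrt (‖spaceGrad w z‖ ^ 2 + (timeDeriv T w z) ^ 2))

/-! ### Assumptions on the coefficients and classical solutions -/

/-- `a ≥ 0` and `a ≠ 0` almost everywhere in the closure of `Ω`, and `1/a ∈ L^p(Ω)` for some
`0 < p < ∞`. -/
def AssumptionA1 {d : ℕ} (Ω : Set (EuclideanSpace ℝ (Fin d)))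
    (a : EuclideanSpace ℝ (Fin d) → ℝ) : Prop :=
  (∀ᵐ x ∂(volume.restrict (closure Ω)), 0 ≤ a x ∧ a x ≠ 0) ∧
    ∃ p : ℝ, 0 < p ∧ MemLp (fun x => (a x)⁻¹) (ENNReal.ofReal p) (volume.restrict Ω)

/-- `f` is of class `C^{k-1}` on `closure Ω × ℝ`, `k > 3`, and all its partial derivatives of
order `i` in `x` and order `j` in the last variable with `i + j ≤ k - 1` are bounded by
`c |s|^{(r+1-j)⁺}`; the exponent `r` is subject to the restrictions that depend on `d`. -/
def AssumptionA2 {d : ℕ} (Ω : Set (EuclideanSpace ℝ (Fin d)))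
    (f : EuclideanSpace ℝ (Fin d) × ℝ → ℝ) (k : ℕ) (c r : ℝ) : Prop :=
  3 < k ∧ 0 < c ∧
  1 ≤ r ∧ (2 < d → d ≤ 4 → r < ((d : ℝ) + 2) / ((d : ℝ) - 2)) ∧ (d = 5 → r < 2) ∧
  ContDiffOn ℝ ((k - 1 : ℕ) : WithTop ℕ∞) f (closure Ω ×ˢ univ) ∧
  ∀ i j : ℕ, i + j ≤ k - 1 → ∀ l : Fin i → Fin d, ∀ x ∈ closure Ω, ∀ s : ℝ,
    |iteratedFDerivWithin ℝ (i + j) f (closure Ω ×ˢ univ) (x, s)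
        (Fin.append
          (fun m => ((EuclideanSpace.single (l m) (1 : ℝ), 0) : EuclideanSpace ℝ (Fin d) × ℝ))
          (fun _ => ((0, 1) : EuclideanSpace ℝ (Fin d) × ℝ)))| ≤
      c * |s| ^ (max (r + 1 - (j : ℝ)) 0)

/-- `u` is a classical solution, of class `C²` on `closure Ω × [0,T]`, of
`u_tt - Δu + a(x) u_t + f(x,u) = 0` in `Ω × [0,T]` with `u(x,0) = u₀(x)` and `u_t(x,0) = u₁(x)` on
`Ω` and `u = 0` on `∂Ω × [0,T]`. -/
structure IsClassicalSolution {d : ℕ} (Ω : Set (EuclideanSpace ℝ (Fin d))) (T : ℝ)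
    (a : EuclideanSpace ℝ (Fin d) → ℝ) (f : EuclideanSpace ℝ (Fin d) × ℝ → ℝ)
    (u₀ u₁ : EuclideanSpace ℝ (Fin d) → ℝ) (u : EuclideanSpace ℝ (Fin d) × ℝ → ℝ) : Prop where
  contDiffOn : ContDiffOn ℝ 2 u (cylinder (closure Ω) T)
  equation : ∀ x ∈ Ω, ∀ t ∈ Icc 0 T,
    timeDeriv T (timeDeriv T u) (x, t) - spaceLaplacian u (x, t) + a x * timeDeriv T u (x, t)
      + f (x, u (x, t)) = 0
  initial : ∀ x ∈ Ω, u (x, 0) = u₀ x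
  initial_deriv : ∀ x ∈ Ω, timeDeriv T u (x, 0) = u₁ x
  boundary : ∀ x ∈ frontier Ω, ∀ t ∈ Icc 0 T, u (x, t) = 0

/-! ### Residuals of a function `v` of `(x,t)` -/

noncomputable def residualPDE {d : ℕ} (T : ℝ) (a : EuclideanSpace ℝ (Fin d) → ℝ)
    (f : EuclideanSpace ℝ (Fin d) × ℝ → ℝ) (v : EuclideanSpace ℝ (Fin d) × ℝ → ℝ)
    (z : EuclideanSpace ℝ (Fin d) × ℝ) : ℝ :=
  timeDeriv T (timeDeriv T v) z - spaceLaplacian v z + a z.1 * timeDeriv T v z + f (z.1, v z)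

noncomputable def residualU0 {d : ℕ} (u₀ : EuclideanSpace ℝ (Fin d) → ℝ)
    (v : EuclideanSpace ℝ (Fin d) × ℝ → ℝ) (x : EuclideanSpace ℝ (Fin d)) : ℝ :=
  v (x, 0) - u₀ x

noncomputable def residualU1 {d : ℕ} (T : ℝ) (u₁ : EuclideanSpace ℝ (Fin d) → ℝ)
    (v : EuclideanSpace ℝ (Fin d) × ℝ → ℝ) (x : EuclideanSpace ℝ (Fin d)) : ℝ :=
  timeDeriv T v (x, 0) - u₁ x

noncomputable def residualGrad {d : ℕ} (u₀ : EuclideanSpace ℝ (Fin d) → ℝ)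
    (v : EuclideanSpace ℝ (Fin d) × ℝ → ℝ) (x : EuclideanSpace ℝ (Fin d)) :
    EuclideanSpace ℝ (Fin d) :=
  spaceGrad v (x, 0) - gradient u₀ x

/-- The boundary residual `v_t` on `∂Ω × [0,T]`. -/
noncomputable def residualBdryUt {d : ℕ} (T : ℝ) (v : EuclideanSpace ℝ (Fin d) × ℝ → ℝ)
    (z : EuclideanSpace ℝ (Fin d) × ℝ) : ℝ :=
  timeDeriv T v z

/-- The constant `Ĉ = 2^{r-1} c (‖u‖_{C⁰}^r + ‖w‖_{C⁰}^r / (r+1))`, where `w` is the error. -/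
noncomputable def nonlinearityConst {d : ℕ} (Ω : Set (EuclideanSpace ℝ (Fin d))) (T c r : ℝ)
    (u w : EuclideanSpace ℝ (Fin d) × ℝ → ℝ) : ℝ :=
  2 ^ (r - 1) * c * ((normC0 Ω T u) ^ r + 1 / (r + 1) * (normC0 Ω T w) ^ r)

/-! ### Neural networks -/

/-- Weights and biases of a feed-forward neural network with input width `m` and output width `n`:
a last (affine) layer, preceded by any number of hidden layers. -/
inductive NeuralNet : ℕ → ℕ → Type
  | output {m n : ℕ} (W : Matrix (Fin n) (Fin m) ℝ) (b : Fin n → ℝ) : NeuralNet m n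
  | hidden {m l n : ℕ} (W : Matrix (Fin l) (Fin m) ℝ) (b : Fin l → ℝ) (next : NeuralNet l n) :
      NeuralNet m n

/-- The realization of a network with activation function `σ`. -/
def NeuralNet.realize (σ : ℝ → ℝ) : {m n : ℕ} → NeuralNet m n → (Fin m → ℝ) → (Fin n → ℝ)
  | _, _, .output W b, z => Matrix.mulVec W z + b
  | _, _, .hidden W b next, z => next.realize σ (fun i => σ ((Matrix.mulVec W z + b) i))

/-- The number of layers. -/
def NeuralNet.depth : {m n : ℕ} → NeuralNet m n → ℕ
  | _, _, .output _ _ => 1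
  | _, _, .hidden _ _ next => next.depth + 1

/-- All widths (including those of input and output) lie in `{1, …, w}`. -/
def NeuralNet.WidthsLE (w : ℕ) : {m n : ℕ} → NeuralNet m n → Prop
  | m, n, .output _ _ => (1 ≤ m ∧ m ≤ w) ∧ 1 ≤ n ∧ n ≤ w
  | m, _, .hidden _ _ next => (1 ≤ m ∧ m ≤ w) ∧ next.WidthsLE w

/-- All weights and biases lie in `[-R, R]`. -/
def NeuralNet.ParamsLE (R : ℝ≥0∞) : {m n : ℕ} → NeuralNet m n → Prop
  | _, _, .output W b => (∀ i j, ‖W i j‖ₑ ≤ R) ∧ ∀ i, ‖b i‖ₑ ≤ R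
  | _, _, .hidden W b next =>
      ((∀ i j, ‖W i j‖ₑ ≤ R) ∧ ∀ i, ‖b i‖ₑ ≤ R) ∧ next.ParamsLE R

/-- The parameter space `Θ_{L,W,R}`, for given input and output widths. -/
def parameterSpace (L w : ℕ) (R : ℝ≥0∞) (m n : ℕ) : Set (NeuralNet m n) :=
  {θ | θ.depth ≤ L ∧ θ.WidthsLE w ∧ θ.ParamsLE R}

/-- The function `u_θ(x,t)` realized by a network with input `z = (x,t) ∈ ℝ^{d+1}` and scalar
output. -/
def pinn {d : ℕ} (σ : ℝ → ℝ) (θ : NeuralNet (d + 1) 1) : EuclideanSpace ℝ (Fin d) × ℝ → ℝ :=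
  fun z => θ.realize σ (Fin.snoc (α := fun _ => ℝ) (fun i => z.1 i) z.2) 0

end WavePINN

/-! The proof is an energy estimate for the error `w = v - u`, where `v` is the network. Subtracting
the equation of `u` gives `w_tt - Δw = R - a w_t - (f(x,v) - f(x,u))` with `R` the interior
residual, and the time derivative of `|∇w|² + w_t²` is `2 w_t (w_tt - Δw) + 2 div(w_t ∇w)`.

In the first term the damping has the good sign because `a ≥ 0`, `2 w_t R ≤ R² + w_t²`, and the
growth of `∂_s f` turns the nonlinearity into `Ĉ (w² + w_t²)`; this is `two_mul_cylDeriv_mul_le`.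
The second term is a boundary flux. On `∂Ω` the function `w_t` is the boundary residual, since `u`
vanishes there at all times, and `|∇w|` is at most the `C¹` norm; Cauchy–Schwarz over `∂Ω × [0,T]`
then gives the factor `√(T|∂Ω|)`. The `L²` norm of `w` is recovered from `w(·,0)` and `w_t` by
integration in time, and Gronwall closes the estimate (`intervalIntegral_sq_add_sq_le`). The
constant `Cpw` enters through `M ≥ 1` and `M · 2/Cpw² ≥ 4`, where `M = max 1 (2 Cpw²)`; these absorb
the numerical constants.

Only the size of the flux matters, so a one-sided divergence theorem suffices: `|∫_Ω div F| ≤ ∫_{∂Ω}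
|F|` for bounded open sets whose boundary has finite surface measure
(`enorm_setIntegral_divergence_le`). No normal vector is needed. For a directional derivative, `Ω`
is sliced by parallel lines. On almost every line the boundary is a finite set, the fundamental
theorem of calculus bounds the integral by the sum of `|φ|` over that set, and these sums integrate
to at most `∫_{∂Ω} |φ|` because orthogonal projection is 1-Lipschitz
(`exists_measurable_sum_fiber_le_lintegral`). For a vector field, a fine partition of unity makes
`F` nearly constant on each piece, so that its divergence is nearly one directional derivative and
no dimensional constant is lost. -/

/-! ### Integrals of derivatives over open subsets of the line -/

/-- A connected set that misses the frontier of `U` lies inside `U` or outside `U`. -/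
theorem IsPreconnected.subset_or_disjoint_of_frontier {X : Type*} [TopologicalSpace X]
    {t U : Set X} (ht : IsPreconnected t) (h : Disjoint t (frontier U)) :
    t ⊆ U ∨ Disjoint t U := by
  by_contra! hc
  obtain ⟨x, hxt, hxU⟩ := Set.not_subset.1 hc.1
  obtain ⟨y, hyt, hyU⟩ := Set.not_disjoint_iff.1 hc.2
  have hsplit : ∀ z ∈ t, z ∉ closure U \ interior U := fun z hz => Set.disjoint_left.1 h hz
  obtain ⟨z, -, hz1, hz2⟩ := ht (interior U) (closure U)ᶜ isOpen_interior
    isClosed_closure.isOpen_compl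
    (fun z hz => by
      by_cases hzc : z ∈ closure U
      · exact Or.inl (not_not.1 fun hi => hsplit z hz ⟨hzc, hi⟩)
      · exact Or.inr hzc)
    ⟨y, hyt, not_not.1 fun hi => hsplit y hyt ⟨subset_closure hyU, hi⟩⟩
    ⟨x, hxt, fun hc => hsplit x hxt ⟨hc, fun hi => hxU (interior_subset hi)⟩⟩
  exact hz2 (interior_subset_closure hz1)

/-- The frontier points are swept from left to right. Between consecutive ones `U` is everything or
nothing, so each frontier value is picked up at most once from either side. The coefficient `c`
records whether the last interval before `b` contributed an endpoint term `ψ b` not yet charged to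
`S`. -/
theorem exists_abs_setIntegral_inter_Iio_sub_le {U : Set ℝ} (hU : IsOpen U) (hb : BddBelow U)
    {ψ ψ' : ℝ → ℝ} (hψ : ContinuousOn ψ (closure U)) (hd : ∀ s ∈ U, HasDerivAt ψ (ψ' s) s)
    (hi : IntegrableOn ψ' U) (S : Finset ℝ) :
    ∀ b, (∀ s ∈ S, s < b) → frontier U ∩ Iio b ⊆ S →
      ∃ c : ℝ, (c = 0 ∨ c = 1) ∧ |(∫ s in U ∩ Iio b, ψ' s) - c * ψ b| ≤ ∑ s ∈ S, |ψ s| := by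
  induction S using Finset.induction_on_max with
  | empty =>
    intro b _ hfr
    refine ⟨0, Or.inl rfl, ?_⟩
    -- Without frontier points below `b`, the ray is inside `U` or misses it; boundedness below
    -- excludes the former.
    have hdis : Disjoint (Iio b) (frontier U) := by
      rw [Set.disjoint_left]
      intro x hx hx'
      simpa using hfr ⟨hx', hx⟩
    have : U ∩ Iio b = ∅ := by
      rcases isPreconnected_Iio.subset_or_disjoint_of_frontier hdis with h | h
      · exact absurd (hb.mono h) (not_bddBelow_Iio b)
      · exact h.symm.inter_eq
    simp [this]
  | insert p S hp ih =>
    intro b hlt hfr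
    have hpb : p < b := hlt p (by simp)
    have hpS : p ∉ S := fun h => lt_irrefl _ (hp p h)
    obtain ⟨c, hc, hle⟩ := ih p hp (by
      rintro x ⟨hx, hxp⟩
      have := hfr ⟨hx, lt_trans hxp hpb⟩
      simp only [Finset.coe_insert, Set.mem_insert_iff] at this
      exact this.resolve_left (ne_of_lt hxp))
    have hdis : Disjoint (Ioo p b) (frontier U) := by
      rw [Set.disjoint_left]
      intro x hx hx'
      have := hfr ⟨hx', hx.2⟩
      simp only [Finset.coe_insert, Set.mem_insert_iff] at this
      rcases this with h | h
      · exact (ne_of_gt hx.1) h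
      · exact lt_asymm hx.1 (hp x h)
    have hsplit : (∫ s in U ∩ Iio b, ψ' s)
        = (∫ s in U ∩ Iio p, ψ' s) + ∫ s in U ∩ Ioo p b, ψ' s := by
      rw [← setIntegral_union]
      · apply setIntegral_congr_set
        have h1 : (U ∩ Iio p) ∪ (U ∩ Ioo p b) = (U ∩ Iio b) \ {p} := by
          ext x
          simp only [mem_union, mem_inter_iff, mem_Iio, mem_Ioo, mem_sdiff, mem_singleton_iff]
          constructor
          · rintro (⟨h, h'⟩ | ⟨h, h', h''⟩)
            · exact ⟨⟨h, h'.trans hpb⟩, h'.ne⟩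
            · exact ⟨⟨h, h''⟩, h'.ne'⟩
          · rintro ⟨⟨h, h'⟩, h''⟩
            rcases lt_or_gt_of_ne h'' with h3 | h3
            · exact Or.inl ⟨h, h3⟩
            · exact Or.inr ⟨h, h3, h'⟩
        rw [h1]
        exact (sdiff_null_ae_eq_self (by simp)).symm
      · rw [Set.disjoint_left]
        rintro x ⟨_, hx⟩ ⟨_, hx'⟩
        exact lt_asymm hx hx'.1
      · exact hU.measurableSet.inter measurableSet_Ioo
      · exact hi.mono_set inter_subset_left
      · exact hi.mono_set inter_subset_left
    rw [Finset.sum_insert hpS]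
    rcases isPreconnected_Ioo.subset_or_disjoint_of_frontier hdis with h | h
    · have hcl : Icc p b ⊆ closure U := by
        rw [← closure_Ioo hpb.ne]
        exact closure_mono h
      have hftc : ∫ s in U ∩ Ioo p b, ψ' s = ψ b - ψ p := by
        rw [inter_eq_right.2 h, ← integral_Ioc_eq_integral_Ioo,
          ← intervalIntegral.integral_of_le hpb.le]
        refine intervalIntegral.integral_eq_sub_of_hasDerivAt_of_le hpb.le (hψ.mono hcl)
          (fun x hx => hd x (h hx)) ?_
        rw [intervalIntegrable_iff_integrableOn_Ioo_of_le hpb.le]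
        exact hi.mono_set h
      -- The coefficient of `ψ p` becomes `c - 1`, which still has absolute value at most one for `c
      -- = 0` and `c = 1`.
      refine ⟨1, Or.inr rfl, ?_⟩
      have h1 : (∫ s in U ∩ Iio b, ψ' s) - 1 * ψ b
          = ((∫ s in U ∩ Iio p, ψ' s) - c * ψ p) + (c - 1) * ψ p := by
        rw [hsplit, hftc]; ring
      rw [h1]
      refine (abs_add_le _ _).trans ?_
      rw [add_comm]
      refine add_le_add ?_ hle
      rcases hc with rfl | rfl <;> simp
    · refine ⟨0, Or.inl rfl, ?_⟩
      have h1 : (∫ s in U ∩ Iio b, ψ' s) - 0 * ψ b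
          = ((∫ s in U ∩ Iio p, ψ' s) - c * ψ p) + c * ψ p := by
        rw [hsplit, h.symm.inter_eq]; simp
      rw [h1]
      refine (abs_add_le _ _).trans ?_
      rw [add_comm]
      refine add_le_add ?_ hle
      rcases hc with rfl | rfl <;> simp

/-- The integral of a derivative over a bounded open subset of the line with finite frontier is
bounded by the sum of the absolute values of the function over the frontier. -/
theorem abs_setIntegral_deriv_le_sum_frontier {U : Set ℝ} (hU : IsOpen U)
    (hb : Bornology.IsBounded U)
    {ψ ψ' : ℝ → ℝ} (hψ : ContinuousOn ψ (closure U)) (hd : ∀ s ∈ U, HasDerivAt ψ (ψ' s) s)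
    (hi : IntegrableOn ψ' U) (S : Finset ℝ) (hS : frontier U ⊆ S) :
    |∫ s in U, ψ' s| ≤ ∑ s ∈ S, |ψ s| := by
  obtain ⟨B, hB⟩ := ((hb.closure.union S.finite_toSet.isBounded).bddAbove)
  -- Extension by zero makes the leftover term `c * ψ₁ (B + 1)` vanish, whatever `ψ` is outside the
  -- closure.
  set ψ₁ : ℝ → ℝ := (closure U).indicator ψ
  have hB' : B + 1 ∉ closure U := fun h => by
    have := hB (Or.inl h)
    linarith
  obtain ⟨c, -, hle⟩ := exists_abs_setIntegral_inter_Iio_sub_le hU hb.bddBelow (ψ := ψ₁) (ψ' := ψ')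
    (hψ.congr fun x hx => indicator_of_mem hx _)
    (fun s hs => (hd s hs).congr_of_eventuallyEq (by
      filter_upwards [hU.mem_nhds hs] with x hx
      exact indicator_of_mem (subset_closure hx) _)) hi S (B + 1)
    (fun s hs => by
      have := hB (Or.inr hs)
      linarith)
    (fun x hx => hS hx.1)
  have h1 : U ∩ Iio (B + 1) = U := by
    refine inter_eq_left.2 fun x hx => ?_
    have := hB (Or.inl (subset_closure hx))
    exact lt_of_le_of_lt this (by linarith)
  rw [h1, show ψ₁ (B + 1) = 0 from indicator_of_notMem hB' _, mul_zero, sub_zero] at hle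
  refine hle.trans (Finset.sum_le_sum fun s _ => ?_)
  by_cases h : s ∈ closure U
  · simp [ψ₁, h]
  · simp [ψ₁, h]

/-! ### Fibres of 1-Lipschitz maps (an inequality of Eilenberg type) -/

open Filter Topology Measure in
/-- The counting function of the fibres of a `1`-Lipschitz map, weighted by a lower semicontinuous
function, is dominated by a measurable function whose integral is at most the integral of the
weight against the Hausdorff measure. -/
theorem exists_measurable_sum_fiber_le_lintegral {X Y : Type*} [MetricSpace X] [MeasurableSpace X]
    [BorelSpace X] [TopologicalSpace.SeparableSpace X] [Nonempty X]
    [MetricSpace Y] [MeasurableSpace Y] [BorelSpace Y]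
    {π : X → Y} (hπ : LipschitzWith 1 π) (n : ℕ) {K : Set X} (hK : MeasurableSet K)
    {g : X → ℝ≥0∞} (hg : LowerSemicontinuousOn g K) :
    ∃ G : Y → ℝ≥0∞, Measurable G ∧
      ∫⁻ y, G y ∂(euclideanHausdorffMeasure n) ≤ ∫⁻ x in K, g x ∂(euclideanHausdorffMeasure n) ∧
      ∀ y, ∀ S : Finset X, (∀ x ∈ S, x ∈ K ∧ π x = y) → ∑ x ∈ S, g x ≤ G y := by
  let B : ℕ → ℕ → Set X := fun m j => Metric.closedBall (TopologicalSpace.denseSeq X j) (1 / (m + 1))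
  -- For each `m` these cells partition `K` into measurable pieces of diameter at most `2 / (m +
  -- 1)`.
  let A : ℕ → ℕ → Set X := fun m j => K ∩ disjointed (B m) j
  have hBm : ∀ m j, MeasurableSet (B m j) := fun m j => Metric.isClosed_closedBall.measurableSet
  have hAm : ∀ m j, MeasurableSet (A m j) := fun m j =>
    hK.inter (MeasurableSet.disjointed (hBm m) j)
  have hAd : ∀ m, Pairwise (Function.onFun Disjoint (A m)) := fun m i j hij =>
    ((disjoint_disjointed (B m) hij).mono inter_subset_right inter_subset_right)
  have hBu : ∀ m, ⋃ j, B m j = univ := by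
    intro m
    refine eq_univ_of_forall fun x => ?_
    obtain ⟨j, hj⟩ := (TopologicalSpace.denseRange_denseSeq X).exists_dist_lt x
      (show (0 : ℝ) < 1 / ((m : ℝ) + 1) by positivity)
    exact mem_iUnion.2 ⟨j, hj.le⟩
  have hAu : ∀ m, ⋃ j, A m j = K := by
    intro m
    rw [← inter_iUnion, iUnion_disjointed, hBu, inter_univ]
  have hAdist : ∀ m j x x', x ∈ A m j → x' ∈ A m j → dist x x' ≤ 2 * (1 / ((m : ℝ) + 1)) := by
    intro m j x x' hx hx'
    have h1 : x ∈ B m j := disjointed_subset _ _ hx.2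
    have h2 : x' ∈ B m j := disjointed_subset _ _ hx'.2
    calc dist x x' ≤ dist x _ + dist x' _ := dist_triangle_right _ _ _
      _ ≤ _ := by
        rw [two_mul]
        exact add_le_add (Metric.mem_closedBall.1 h1) (Metric.mem_closedBall.1 h2)
  have h0 : Tendsto (fun m : ℕ => 2 * (1 / ((m : ℝ) + 1))) atTop (𝓝 0) := by
    simpa using (tendsto_one_div_add_atTop_nhds_zero_nat (𝕜 := ℝ)).const_mul 2
  let I : ℕ → ℕ → ℝ≥0∞ := fun m j => ⨅ x ∈ A m j, g x
  -- Images of measurable sets need not be measurable; measurable hulls have the same measure. `G m`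
  -- counts the cells met by a fibre, each weighted by the infimum of `g` on it.
  let M : ℕ → ℕ → Set Y := fun m j => toMeasurable (euclideanHausdorffMeasure n) (π '' A m j)
  let G : ℕ → Y → ℝ≥0∞ := fun m y => ∑' j, (M m j).indicator (fun _ => I m j) y
  have hGm : ∀ m, Measurable (G m) := fun m =>
    Measurable.tsum fun j => measurable_const.indicator (measurableSet_toMeasurable _ _)
  have hcontr : ∀ s : Set X, (euclideanHausdorffMeasure n : Measure Y) (π '' s)
      ≤ (euclideanHausdorffMeasure n : Measure X) s := by
    intro s
    simp only [euclideanHausdorffMeasure_def, Measure.smul_apply]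
    have := hπ.hausdorffMeasure_image_le (d := n) (by positivity) s
    simp only [ENNReal.coe_one, ENNReal.one_rpow, one_mul] at this
    simp only [ENNReal.smul_def]
    gcongr
  have hGi : ∀ m, ∫⁻ y, G m y ∂(euclideanHausdorffMeasure n)
      ≤ ∫⁻ x in K, g x ∂(euclideanHausdorffMeasure n) := by
    intro m
    rw [lintegral_tsum fun j =>
      (measurable_const.indicator (measurableSet_toMeasurable _ _)).aemeasurable]
    rw [← hAu m, lintegral_iUnion (hAm m) (hAd m)]
    refine ENNReal.tsum_le_tsum fun j => ?_
    rw [lintegral_indicator (measurableSet_toMeasurable _ _), setLIntegral_const,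
      measure_toMeasurable]
    calc I m j * _ ≤ I m j * euclideanHausdorffMeasure n (A m j) := by gcongr; exact hcontr _
      _ = ∫⁻ x in A m j, I m j ∂(euclideanHausdorffMeasure n) := by rw [setLIntegral_const]
      _ ≤ _ := setLIntegral_mono' (hAm m j) fun x hx => iInf₂_le x hx
  -- Fatou's lemma passes the integral bound to the limit. Pointwise, the cells eventually separate
  -- the points of a finite subset of a fibre, and the infima converge to the values of `g`.
  refine ⟨fun y => liminf (fun m => G m y) atTop, .liminf hGm, ?_, ?_⟩
  · refine (lintegral_liminf_le hGm).trans ?_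
    refine (liminf_le_liminf (Eventually.of_forall hGi)).trans ?_
    simp
  · intro y S hS
    have hj : ∀ m, ∀ x : X, ∃ j, x ∈ K → x ∈ A m j := by
      intro m x
      by_cases hx : x ∈ K
      · rw [← hAu m] at hx
        obtain ⟨j, hj⟩ := mem_iUnion.1 hx
        exact ⟨j, fun _ => hj⟩
      · exact ⟨0, fun h => absurd h hx⟩
    choose J hJ using hj
    -- Lower semicontinuity gives the lower bound on shrinking cells; the upper bound is immediate
    -- since `x` lies in its cell.
    have hlim : ∀ x ∈ S, Tendsto (fun m => I m (J m x)) atTop (𝓝 (g x)) := by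
      intro x hx
      have hxK := (hS x hx).1
      refine tendsto_order.2 ⟨fun a ha => ?_, fun a ha => ?_⟩
      · obtain ⟨a', ha1, ha2⟩ := exists_between ha
        have := hg x hxK a' ha2
        obtain ⟨δ, hδ, hball⟩ := Metric.mem_nhdsWithin_iff.1 this
        filter_upwards [h0.eventually (gt_mem_nhds hδ)] with m hm
        refine lt_of_lt_of_le ha1 (le_iInf₂ fun x' hx' => (hball ⟨?_, hx'.1⟩).le)
        exact lt_of_le_of_lt (hAdist m _ x' x hx' (hJ m x hxK)) hm
      · exact Eventually.of_forall fun m =>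
          lt_of_le_of_lt (iInf₂_le x (hJ m x (hS x hx).1)) ha
    have hinj : ∀ᶠ m in atTop, ∀ x ∈ S, ∀ x' ∈ S, J m x = J m x' → x = x' := by
      rw [Filter.eventually_all_finset]
      intro x hx
      rw [Filter.eventually_all_finset]
      intro x' hx'
      by_cases h : x = x'
      · exact Eventually.of_forall fun _ _ => h
      · filter_upwards [h0.eventually (gt_mem_nhds (dist_pos.2 h))] with m hm heq
        have h1 := hJ m x (hS x hx).1
        rw [heq] at h1
        exact absurd (hAdist m _ x x' h1 (hJ m x' (hS x' hx').1)) (not_le.2 hm)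
    have h2 := (tendsto_finsetSum S hlim).liminf_eq
    rw [← h2]
    refine liminf_le_liminf ?_
    filter_upwards [hinj] with m hm
    calc ∑ x ∈ S, I m (J m x) = ∑ j ∈ S.image (J m), I m j := by
          rw [Finset.sum_image fun x hx x' hx' h => hm x hx x' hx' h]
      _ = ∑ j ∈ S.image (J m), (M m j).indicator (fun _ => I m j) y := by
          refine Finset.sum_congr rfl fun j hj => ?_
          obtain ⟨x, hx, rfl⟩ := Finset.mem_image.1 hj
          rw [indicator_of_mem]
          exact subset_toMeasurable _ _ ⟨x, hJ m x (hS x hx).1, (hS x hx).2⟩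
      _ ≤ _ := ENNReal.sum_le_tsum _

/-! ### Directional derivatives by slicing along parallel lines -/

open Module in
theorem finrank_orthogonal_span_unit {V : Type*} [NormedAddCommGroup V] [InnerProductSpace ℝ V]
    [FiniteDimensional ℝ V] {e : V} (he : ‖e‖ = 1) :
    finrank ℝ (ℝ ∙ e)ᗮ = finrank ℝ V - 1 := by
  have h1 := (ℝ ∙ e).finrank_add_finrank_orthogonal
  have h2 := finrank_span_singleton (K := ℝ) (v := e) (by rintro rfl; simp at he)
  omega

section

variable {V : Type*} [NormedAddCommGroup V] [InnerProductSpace ℝ V] [FiniteDimensional ℝ V]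
  [MeasurableSpace V] [BorelSpace V]

open Module Measure in
/-- The parametrisation of the space by a line and its orthogonal complement preserves volume. -/
theorem measurePreserving_smul_add_orthogonal {e : V} (he : ‖e‖ = 1) :
    MeasurePreserving (fun p : ℝ × (ℝ ∙ e)ᗮ => p.1 • e + (p.2 : V)) volume volume := by
  have h1 := ((ℝ ∙ e).measurePreserving_measurableEquivProd (0 : V)).symm
  rw [InnerProductSpace.euclideanHausdorffMeasure_eq_volume] at h1
  have h2 := (LinearIsometryEquiv.toSpanUnitSingleton (𝕜 := ℝ) e he).measurePreserving
  have h3 := h1.comp (h2.prod (MeasurePreserving.id (volume : Measure (ℝ ∙ e)ᗮ)))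
  have h4 : (fun p : ℝ × (ℝ ∙ e)ᗮ => p.1 • e + (p.2 : V)) = ((ℝ ∙ e).measurableEquivProd 0).symm ∘
      Prod.map (LinearIsometryEquiv.toSpanUnitSingleton e he) id := by
    ext p
    simp
  rw [h4]
  exact h3

theorem measurableEmbedding_smul_add_orthogonal {e : V} (he : ‖e‖ = 1) :
    MeasurableEmbedding (fun p : ℝ × (ℝ ∙ e)ᗮ => p.1 • e + (p.2 : V)) := by
  have h1 := ((ℝ ∙ e).measurableEquivProd (0 : V)).symm.measurableEmbedding
  have h3 := h1.comp (((LinearIsometryEquiv.toSpanUnitSingleton (𝕜 := ℝ) e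
    he).toHomeomorph.toMeasurableEquiv.prodCongr (MeasurableEquiv.refl (ℝ ∙ e)ᗮ)).measurableEmbedding)
  convert h3 using 1
  ext p
  simp [LinearIsometryEquiv.toSpanUnitSingleton, MeasurableEquiv.prodCongr]

open Module Measure in
/-- The integral of a directional derivative over a bounded open set whose boundary has finite
surface measure is at most the surface integral of the function. -/
theorem enorm_setIntegral_lineDeriv_le_of_norm_eq_one {Ω : Set V} (hΩ : IsOpen Ω)
    (hb : Bornology.IsBounded Ω)
    (hfin : (euclideanHausdorffMeasure (finrank ℝ V - 1) : Measure V) (frontier Ω) ≠ ∞)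
    {φ g : V → ℝ} {e : V} (he : ‖e‖ = 1) (hφ : ContinuousOn φ (closure Ω))
    (hd : ∀ x ∈ Ω, HasLineDerivAt ℝ φ (g x) x e) (hg : IntegrableOn g Ω) :
    ‖∫ x in Ω, g x‖ₑ ≤
      ∫⁻ x in frontier Ω, ‖φ x‖ₑ ∂(euclideanHausdorffMeasure (finrank ℝ V - 1)) := by
  set W := (ℝ ∙ e)ᗮ
  set Ψ : ℝ × W → V := fun p => p.1 • e + (p.2 : V) with hΨ
  have hΨm : MeasurePreserving Ψ volume volume := measurePreserving_smul_add_orthogonal he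
  have hΨe : MeasurableEmbedding Ψ := measurableEmbedding_smul_add_orthogonal he
  have hvol : (euclideanHausdorffMeasure (finrank ℝ V - 1) : Measure W) = volume := by
    rw [← finrank_orthogonal_span_unit he]
    exact InnerProductSpace.euclideanHausdorffMeasure_eq_volume
  let π : V → W := W.orthogonalProjectionOnto
  have hπ : LipschitzWith 1 π :=
    W.orthogonalProjectionOnto.lipschitz.weaken
      (by exact_mod_cast W.orthogonalProjectionOnto_norm_le)
  have heW : W.orthogonalProjectionOnto e = 0 := by
    rw [Submodule.orthogonalProjectionOnto_eq_zero_iff]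
    exact Submodule.le_orthogonal_orthogonal _ (Submodule.mem_span_singleton_self e)
  have hπΨ : ∀ s y, π (Ψ (s, y)) = y := by
    intro s y
    simp only [π, hΨ, map_add, map_smul, heW, smul_zero, zero_add]
    exact Submodule.orthogonalProjectionOnto_mem_subspace_eq_self y
  have hφK : ContinuousOn φ (frontier Ω) := hφ.mono frontier_subset_closure
  obtain ⟨G, hGm, hGi, hG⟩ := exists_measurable_sum_fiber_le_lintegral hπ (finrank ℝ V - 1)
    isClosed_frontier.measurableSet (K := frontier Ω) (g := fun x => ‖φ x‖ₑ)
    (hφK.enorm.lowerSemicontinuousOn)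
  -- With weight one, `N` bounds the number of boundary points on each line. Its integral is at most
  -- the surface measure of the frontier, so almost every line meets the frontier finitely often.
  obtain ⟨N, hNm, hNi, hN⟩ := exists_measurable_sum_fiber_le_lintegral hπ (finrank ℝ V - 1)
    isClosed_frontier.measurableSet (K := frontier Ω) (g := fun _ => 1)
    (continuousOn_const.lowerSemicontinuousOn)
  rw [hvol] at hGi hNi
  have hNfin : ∀ᵐ y, N y < ∞ := by
    refine ae_lt_top hNm (ne_of_lt (lt_of_le_of_lt hNi ?_))
    simpa using hfin.lt_top
  have hind : Integrable (fun p => Ω.indicator g (Ψ p)) := by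
    exact (hΨm.integrable_comp_emb hΨe).2 (hg.integrable_indicator hΩ.measurableSet)
  have h1 : ∫ x in Ω, g x = ∫ y : W, ∫ s : ℝ, Ω.indicator g (Ψ (s, y)) := by
    rw [← integral_indicator hΩ.measurableSet, ← hΨm.integral_comp hΨe, volume_eq_prod,
      integral_prod_symm]
    exact hind
  rw [h1]
  refine (enorm_integral_le_lintegral_enorm _).trans (le_trans ?_ hGi)
  refine lintegral_mono_ae ?_
  have hsec : ∀ᵐ y : W, Integrable (fun s : ℝ => Ω.indicator g (Ψ (s, y))) := by
    rw [volume_eq_prod] at hind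
    exact hind.prod_left_ae
  filter_upwards [hNfin, hsec] with y hy hys
  have hinj : Function.Injective fun s : ℝ => Ψ (s, y) := fun s s' h =>
    congrArg Prod.fst (hΨe.injective h)
  have hcont : Continuous fun s : ℝ => Ψ (s, y) := by
    simp only [hΨ]; fun_prop
  let S : Set ℝ := (fun s => Ψ (s, y)) ⁻¹' frontier Ω
  have hSfin : S.Finite := by
    by_contra hinf
    obtain ⟨n, hn⟩ := ENNReal.exists_nat_gt hy.ne
    obtain ⟨t, htS, htc⟩ := Set.Infinite.exists_subset_card_eq hinf n
    have := hN y (t.map ⟨_, hinj⟩) (by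
      intro x hx
      obtain ⟨s, hs, rfl⟩ := Finset.mem_map.1 hx
      exact ⟨htS hs, hπΨ s y⟩)
    simp only [Finset.sum_const, Finset.card_map, htc, nsmul_eq_mul, mul_one] at this
    exact absurd hn (not_lt.2 this)
  let U : Set ℝ := (fun s => Ψ (s, y)) ⁻¹' Ω
  have hUo : IsOpen U := hΩ.preimage hcont
  have hUcl : closure U ⊆ (fun s => Ψ (s, y)) ⁻¹' closure Ω := hcont.closure_preimage_subset Ω
  have hUb : Bornology.IsBounded U := by
    obtain ⟨C, hC⟩ := hb.exists_norm_le
    refine (Metric.isBounded_closedBall (x := (0 : ℝ)) (r := C + ‖(y : V)‖)).subset fun s hs => ?_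
    have h2 := hC _ hs
    have h3 : ‖s • e‖ ≤ ‖Ψ (s, y)‖ + ‖(y : V)‖ := by
      have : s • e = Ψ (s, y) - y := by simp [hΨ]
      rw [this]
      exact norm_sub_le _ _
    rw [norm_smul, he, mul_one] at h3
    rw [mem_closedBall_zero_iff]
    linarith
  have hint : ∫ s : ℝ, Ω.indicator g (Ψ (s, y)) = ∫ s in U, g (Ψ (s, y)) := by
    rw [← integral_indicator hUo.measurableSet]
    rfl
  rw [hint]
  have hder : ∀ s ∈ U, HasDerivAt (fun s => φ (Ψ (s, y))) (g (Ψ (s, y))) s := by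
    intro s hs
    have h4 := hd _ hs
    rw [HasLineDerivAt] at h4
    have h5 : HasDerivAt (fun t : ℝ => t - s) 1 s := (hasDerivAt_id s).sub_const s
    have h6 := HasDerivAt.scomp_of_eq s h4 h5 (by simp)
    simp only [one_smul] at h6
    refine h6.congr_of_eventuallyEq (Filter.Eventually.of_forall fun t => ?_)
    simp only [Function.comp, hΨ, sub_smul]
    congr 1
    abel
  have hle := abs_setIntegral_deriv_le_sum_frontier hUo hUb (ψ := fun s => φ (Ψ (s, y)))
    (ψ' := fun s => g (Ψ (s, y))) (hφ.comp hcont.continuousOn hUcl) hder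
    (by
      rw [← integrable_indicator_iff hUo.measurableSet]
      -- The frontier of the slice lies in the slice of the frontier, possibly strictly; extra
      -- points only enlarge the sum.
      exact hys) hSfin.toFinset (by
      rw [hSfin.coe_toFinset]
      exact hcont.frontier_preimage_subset Ω)
  have h7 := hG y (hSfin.toFinset.map ⟨_, hinj⟩) (by
    intro x hx
    obtain ⟨s, hs, rfl⟩ := Finset.mem_map.1 hx
    exact ⟨hSfin.mem_toFinset.1 hs, hπΨ s y⟩)
  refine le_trans ?_ h7
  rw [Finset.sum_map, Real.enorm_eq_ofReal_abs]
  refine (ENNReal.ofReal_le_ofReal hle).trans ?_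
  rw [ENNReal.ofReal_sum_of_nonneg fun _ _ => abs_nonneg _]
  simp [Real.enorm_eq_ofReal_abs]

open Module Measure in
theorem enorm_setIntegral_lineDeriv_le {Ω : Set V} (hΩ : IsOpen Ω)
    (hb : Bornology.IsBounded Ω)
    (hfin : (euclideanHausdorffMeasure (finrank ℝ V - 1) : Measure V) (frontier Ω) ≠ ∞)
    {φ g : V → ℝ} {v : V} (hφ : ContinuousOn φ (closure Ω))
    (hd : ∀ x ∈ Ω, HasLineDerivAt ℝ φ (g x) x v) (hg : IntegrableOn g Ω) :
    ‖∫ x in Ω, g x‖ₑ ≤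
      ‖v‖ₑ * ∫⁻ x in frontier Ω, ‖φ x‖ₑ ∂(euclideanHausdorffMeasure (finrank ℝ V - 1)) := by
  rcases eq_or_ne v 0 with rfl | hv
  · have : ∀ x ∈ Ω, g x = 0 := fun x hx => by
      have h := hd x hx
      rw [HasLineDerivAt] at h
      simp only [smul_zero, add_zero] at h
      exact h.unique (hasDerivAt_const _ _)
    rw [setIntegral_congr_fun hΩ.measurableSet this]
    simp
  · have hv' : ‖v‖ ≠ 0 := norm_ne_zero_iff.2 hv
    have hgeq : ∀ x, g x = ‖v‖ * (‖v‖⁻¹ * g x) := fun x => by field_simp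
    have h := enorm_setIntegral_lineDeriv_le_of_norm_eq_one hΩ hb hfin (e := ‖v‖⁻¹ • v)
      (g := fun x => ‖v‖⁻¹ * g x) (by
        rw [norm_smul, norm_inv, norm_norm, inv_mul_cancel₀ hv']) hφ
      (fun x hx => (hd x hx).smul _) (hg.const_mul _)
    have h2 : ∫ x in Ω, g x = ‖v‖ * ∫ x in Ω, ‖v‖⁻¹ * g x := by
      rw [← integral_const_mul]
      exact integral_congr_ae (Filter.Eventually.of_forall hgeq)
    rw [h2, enorm_mul, enorm_norm]
    gcongr

end

/-! ### The one-sided divergence theorem -/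

open scoped Manifold ContDiff in
/-- A finite smooth partition of unity on a compact set, at a given scale. -/
theorem exists_finite_smooth_partition {V : Type*} [NormedAddCommGroup V] [NormedSpace ℝ V]
    [FiniteDimensional ℝ V] {D : Set V} (hD : IsCompact D) {δ : ℝ} (hδ : 0 < δ) :
    ∃ (T : Finset D) (f : D → V → ℝ), (∀ k, ContDiff ℝ 1 (f k)) ∧ (∀ k x, 0 ≤ f k x) ∧
      (∀ k x, f k x ≠ 0 → dist x k < δ) ∧ ∀ x ∈ D, ∑ k ∈ T, f k x = 1 := by
  obtain ⟨f, hf⟩ := SmoothPartitionOfUnity.exists_isSubordinate 𝓘(ℝ, V) hD.isClosed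
    (fun k : D => Metric.ball (k : V) δ) (fun _ => Metric.isOpen_ball)
    (fun x hx => mem_iUnion.2 ⟨⟨x, hx⟩, Metric.mem_ball_self hδ⟩)
  have hfin := f.locallyFinite.finite_nonempty_inter_compact hD
  refine ⟨hfin.toFinset, fun k => f k, fun k => ?_, fun k x => f.nonneg k x, fun k x hx => ?_,
    fun x hx => ?_⟩
  · exact (contMDiff_iff_contDiff.1 (f k).contMDiff).of_le (by simp)
  · exact hf k (subset_tsupport _ hx)
  · rw [← f.sum_eq_one hx]
    refine (finsum_eq_sum_of_support_subset _ fun k hk => ?_).symm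
    simp only [Finite.coe_toFinset, mem_ofPred_eq]
    exact ⟨x, hk, hx⟩

section

variable {V : Type*} [NormedAddCommGroup V] [InnerProductSpace ℝ V] [FiniteDimensional ℝ V]
  [MeasurableSpace V] [BorelSpace V] {ι : Type*} [Fintype ι]

-- With a constant vector `c`, `div(ψF) = ∂_c ψ + ∑ ∂_i (ψ ⟨b_i, F - c⟩)`. The first term is a
-- single directional derivative and costs `‖c‖ ∫ |ψ|` with constant one, where `‖c‖ ≤ ‖F‖ + η`
-- wherever `ψ ≠ 0`. Each coordinate of the remainder costs only `η ∫ |ψ|`. This explains the factor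
-- `1 + card ι`, and why the main term carries no dimensional factor.
open Module in
theorem enorm_setIntegral_divergence_mul_le (b : OrthonormalBasis ι ℝ V) {Ω : Set V}
    (hΩ : IsOpen Ω) (hb : Bornology.IsBounded Ω)
    (hfin : (Measure.euclideanHausdorffMeasure (finrank ℝ V - 1) : Measure V) (frontier Ω) ≠ ∞)
    {F : V → V} {F' : V → V →L[ℝ] V} (hF : ContinuousOn F (closure Ω))
    (hd : ∀ x ∈ Ω, HasFDerivAt F (F' x) x) (hi : IntegrableOn F' Ω)
    {ψ : V → ℝ} (hψ : ContDiff ℝ 1 ψ) {c : V} {η : ℝ} (hη : 0 ≤ η)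
    (hc : ∀ x ∈ closure Ω, ψ x ≠ 0 → ‖F x - c‖ ≤ η) :
    IntegrableOn (fun x => ∑ i, (ψ x * inner ℝ (b i) (F' x (b i))
        + fderiv ℝ ψ x (b i) * inner ℝ (b i) (F x))) Ω ∧
    ‖∫ x in Ω, ∑ i, (ψ x * inner ℝ (b i) (F' x (b i))
        + fderiv ℝ ψ x (b i) * inner ℝ (b i) (F x))‖ₑ ≤
      ∫⁻ x in frontier Ω, ‖ψ x‖ₑ * (‖F x‖ₑ + ENNReal.ofReal ((1 + Fintype.card ι) * η))
        ∂(Measure.euclideanHausdorffMeasure (finrank ℝ V - 1)) := by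
  set H : Measure V := Measure.euclideanHausdorffMeasure (finrank ℝ V - 1)
  have hD : IsCompact (closure Ω) := hb.isCompact_closure
  have hψd : Continuous (fderiv ℝ ψ) := hψ.continuous_fderiv one_ne_zero
  have hcont_int : ∀ h : V → ℝ, ContinuousOn h (closure Ω) → IntegrableOn h Ω := fun h hh =>
    (hh.integrableOn_compact hD).mono_set subset_closure
  have hψint : ∀ i, IntegrableOn (fun x => ψ x * inner ℝ (b i) (F' x (b i))) Ω := by
    intro i
    have h1 : IntegrableOn (fun x => inner ℝ (b i) (F' x (b i))) Ω :=
      ((innerSL ℝ (b i)).comp (ContinuousLinearMap.apply ℝ V (b i))).integrable_comp hi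
    obtain ⟨C, hC⟩ := hD.exists_bound_of_continuousOn hψ.continuous.continuousOn
    refine h1.bdd_mul hψ.continuous.aestronglyMeasurable (c := C) ?_
    filter_upwards [ae_restrict_mem hΩ.measurableSet] with x hx using hC x (subset_closure hx)
  have hψdint : IntegrableOn (fun x => fderiv ℝ ψ x c) Ω :=
    hcont_int _ (by fun_prop)
  let g : ι → V → ℝ := fun i x => ψ x * inner ℝ (b i) (F' x (b i))
    + fderiv ℝ ψ x (b i) * inner ℝ (b i) (F x - c)
  have hgint : ∀ i, IntegrableOn (g i) Ω := fun i =>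
    (hψint i).add (hcont_int _ (by fun_prop))
  have hsum : ∀ x, ∑ i, (ψ x * inner ℝ (b i) (F' x (b i))
      + fderiv ℝ ψ x (b i) * inner ℝ (b i) (F x)) = fderiv ℝ ψ x c + ∑ i, g i x := by
    intro x
    have h1 : fderiv ℝ ψ x c = ∑ i, fderiv ℝ ψ x (b i) * inner ℝ (b i) c := by
      conv_lhs => rw [← b.sum_repr' c]
      simp [map_sum, mul_comm]
    rw [h1, ← Finset.sum_add_distrib]
    refine Finset.sum_congr rfl fun i _ => ?_
    simp only [g, inner_sub_right]
    ring
  have hφd : ∀ i, ∀ x ∈ Ω, HasLineDerivAt ℝ (fun x => ψ x * inner ℝ (b i) (F x - c)) (g i x) x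
      (b i) := by
    intro i x hx
    have h1 : HasFDerivAt ψ (fderiv ℝ ψ x) x := (hψ.differentiable one_ne_zero x).hasFDerivAt
    have h2 : HasFDerivAt (fun x => inner ℝ (b i) (F x - c)) ((innerSL ℝ (b i)).comp (F' x)) x :=
      (innerSL ℝ (b i)).hasFDerivAt.comp x ((hd x hx).sub_const c)
    have h3 := (h1.mul h2).hasLineDerivAt (b i)
    have h4 : g i x = (ψ x • (innerSL ℝ (b i)).comp (F' x)
        + inner ℝ (b i) (F x - c) • fderiv ℝ ψ x) (b i) := by
      simp [g]
      ring
    rw [h4]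
    exact h3
  have hmain0 : ‖∫ x in Ω, fderiv ℝ ψ x c‖ₑ ≤ ‖c‖ₑ * ∫⁻ x in frontier Ω, ‖ψ x‖ₑ ∂H :=
    enorm_setIntegral_lineDeriv_le hΩ hb hfin hψ.continuous.continuousOn
      (fun x _ => (hψ.differentiable one_ne_zero x).hasFDerivAt.hasLineDerivAt c) hψdint
  have hmaini : ∀ i, ‖∫ x in Ω, g i x‖ₑ ≤
      ∫⁻ x in frontier Ω, ‖ψ x * inner ℝ (b i) (F x - c)‖ₑ ∂H := by
    intro i
    have h := enorm_setIntegral_lineDeriv_le hΩ hb hfin (φ := fun x => ψ x * inner ℝ (b i) (F x - c))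
      (v := b i)
      (hψ.continuous.continuousOn.mul (by fun_prop)) (hφd i) (hgint i)
    have hbi : ‖b i‖ₑ = 1 := by
      rw [← ofReal_norm, b.norm_eq_one]; simp
    rwa [hbi, one_mul] at h
  have hfrm : MeasurableSet (frontier Ω) := isClosed_frontier.measurableSet
  have hbound0 : ‖c‖ₑ * ∫⁻ x in frontier Ω, ‖ψ x‖ₑ ∂H ≤
      ∫⁻ x in frontier Ω, ‖ψ x‖ₑ * (‖F x‖ₑ + ENNReal.ofReal η) ∂H := by
    rw [← lintegral_const_mul _ hψ.continuous.enorm.measurable]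
    refine setLIntegral_mono' hfrm fun x hx => ?_
    by_cases h0 : ψ x = 0
    · simp [h0]
    · rw [mul_comm]
      gcongr
      have h1 := hc x (frontier_subset_closure hx) h0
      rw [← ofReal_norm, ← ofReal_norm, ← ENNReal.ofReal_add (norm_nonneg _) hη]
      refine ENNReal.ofReal_le_ofReal ?_
      have := norm_sub_norm_le c (F x)
      rw [norm_sub_rev] at this
      linarith
  have hboundi : ∀ i, ∫⁻ x in frontier Ω, ‖ψ x * inner ℝ (b i) (F x - c)‖ₑ ∂H ≤
      ∫⁻ x in frontier Ω, ‖ψ x‖ₑ * ENNReal.ofReal η ∂H := by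
    intro i
    refine setLIntegral_mono' hfrm fun x hx => ?_
    by_cases h0 : ψ x = 0
    · simp [h0]
    · rw [enorm_mul]
      gcongr
      have h1 := hc x (frontier_subset_closure hx) h0
      rw [← ofReal_norm]
      refine ENNReal.ofReal_le_ofReal (le_trans (norm_inner_le_norm _ _) ?_)
      rwa [b.norm_eq_one, one_mul]
  have hsumint : IntegrableOn (fun x => fderiv ℝ ψ x c + ∑ i, g i x) Ω :=
    hψdint.add (integrable_finsetSum _ fun i _ => hgint i)
  simp only [hsum]
  refine ⟨hsumint, ?_⟩
  rw [integral_add hψdint (integrable_finsetSum _ fun i _ => hgint i),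
    integral_finsetSum _ fun i _ => hgint i]
  calc _ ≤ ‖∫ x in Ω, fderiv ℝ ψ x c‖ₑ + ∑ i, ‖∫ x in Ω, g i x‖ₑ :=
        (enorm_add_le _ _).trans (by gcongr; exact enorm_sum_le _ _)
    _ ≤ ∫⁻ x in frontier Ω, ‖ψ x‖ₑ * (‖F x‖ₑ + ENNReal.ofReal η) ∂H
        + ∑ i : ι, ∫⁻ x in frontier Ω, ‖ψ x‖ₑ * ENNReal.ofReal η ∂H := by
      gcongr with i
      · exact hmain0.trans hbound0
      · exact (hmaini i).trans (hboundi i)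
    _ = _ := by
      have hm : Measurable fun x => ‖ψ x‖ₑ * ENNReal.ofReal η :=
        hψ.continuous.enorm.measurable.mul_const _
      rw [← lintegral_finsetSum _ fun i _ => hm,
        ← lintegral_add_right _ (Finset.measurable_fun_sum _ fun i _ => hm)]
      refine lintegral_congr fun x => ?_
      rw [add_mul, one_mul, ENNReal.ofReal_add hη (by positivity), ENNReal.ofReal_mul (by positivity)]
      simp only [Finset.sum_const, Finset.card_univ, nsmul_eq_mul, ENNReal.ofReal_natCast]
      ring

open Module in
/-- A one-sided divergence theorem: the integral of the divergence of a vector field over a bounded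
open set with boundary of finite surface measure is at most the surface integral of its length. -/
theorem enorm_setIntegral_divergence_le (b : OrthonormalBasis ι ℝ V) {Ω : Set V}
    (hΩ : IsOpen Ω) (hb : Bornology.IsBounded Ω)
    (hfin : (Measure.euclideanHausdorffMeasure (finrank ℝ V - 1) : Measure V) (frontier Ω) ≠ ∞)
    {F : V → V} {F' : V → V →L[ℝ] V} (hF : ContinuousOn F (closure Ω))
    (hd : ∀ x ∈ Ω, HasFDerivAt F (F' x) x) (hi : IntegrableOn F' Ω) :
    ‖∫ x in Ω, ∑ i, inner ℝ (b i) (F' x (b i))‖ₑ ≤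
      ∫⁻ x in frontier Ω, ‖F x‖ₑ ∂(Measure.euclideanHausdorffMeasure (finrank ℝ V - 1)) := by
  set H : Measure V := Measure.euclideanHausdorffMeasure (finrank ℝ V - 1)
  have hD : IsCompact (closure Ω) := hb.isCompact_closure
  have hfrm : MeasurableSet (frontier Ω) := isClosed_frontier.measurableSet
  have hunif := Metric.uniformContinuousOn_iff.1 (hD.uniformContinuousOn_of_continuous hF)
  have key : ∀ η : ℝ, 0 < η → ‖∫ x in Ω, ∑ i, inner ℝ (b i) (F' x (b i))‖ₑ ≤
      ∫⁻ x in frontier Ω, ‖F x‖ₑ ∂H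
        + ENNReal.ofReal ((1 + Fintype.card ι) * η) * H (frontier Ω) := by
    intro η hη
    obtain ⟨δ, hδ, hFδ⟩ := hunif η hη
    -- The scale `δ` is a modulus of uniform continuity of `F` for `η`, so on the support of `f k`
    -- the field is within `η` of `F k`.
    obtain ⟨T, f, hf1, hf0, hfδ, hfs⟩ := exists_finite_smooth_partition hD hδ
    have hpiece := fun k : closure Ω => enorm_setIntegral_divergence_mul_le b hΩ hb hfin hF hd hi
      (hf1 k) (c := F k) hη.le (fun x hx h0 => by
        have := hFδ x hx k k.2 (hfδ k x h0)
        rw [dist_eq_norm] at this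
        exact this.le)
    -- The sum of the partition is constant near each point of the open set, so the terms with
    -- derivatives of the cutoffs cancel.
    have hfd : ∀ x ∈ Ω, ∑ k ∈ T, fderiv ℝ (f k) x = 0 := by
      intro x hx
      have h1 : HasFDerivAt (fun x => ∑ k ∈ T, f k x) (∑ k ∈ T, fderiv ℝ (f k) x) x :=
        HasFDerivAt.fun_sum fun k _ => ((hf1 k).differentiable one_ne_zero x).hasFDerivAt
      have h2 : HasFDerivAt (fun x => ∑ k ∈ T, f k x) (0 : V →L[ℝ] ℝ) x :=
        (hasFDerivAt_const (1 : ℝ) x).congr_of_eventuallyEq (by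
          filter_upwards [hΩ.mem_nhds hx] with y hy using hfs y (subset_closure hy))
      exact h1.unique h2
    have hdec : ∫ x in Ω, ∑ i, inner ℝ (b i) (F' x (b i)) = ∑ k ∈ T, ∫ x in Ω,
        ∑ i, (f k x * inner ℝ (b i) (F' x (b i))
          + fderiv ℝ (f k) x (b i) * inner ℝ (b i) (F x)) := by
      rw [← integral_finsetSum _ fun k _ => (hpiece k).1]
      refine setIntegral_congr_fun hΩ.measurableSet fun x hx => ?_
      rw [Finset.sum_comm]
      refine Finset.sum_congr rfl fun i _ => ?_
      rw [Finset.sum_add_distrib, ← Finset.sum_mul, ← Finset.sum_mul, hfs x (subset_closure hx)]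
      have := congrArg (fun A : V →L[ℝ] ℝ => A (b i)) (hfd x hx)
      simp only [_root_.sum_apply, _root_.zero_apply] at this
      rw [this]
      ring
    rw [hdec]
    have hm : AEMeasurable (fun x => ‖F x‖ₑ) (H.restrict (frontier Ω)) :=
      (hF.mono frontier_subset_closure).enorm.aemeasurable hfrm
    calc _ ≤ ∑ k ∈ T, ∫⁻ x in frontier Ω,
          ‖f k x‖ₑ * (‖F x‖ₑ + ENNReal.ofReal ((1 + Fintype.card ι) * η)) ∂H :=
          (enorm_sum_le _ _).trans (Finset.sum_le_sum fun k _ => (hpiece k).2)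
      _ = ∫⁻ x in frontier Ω, ∑ k ∈ T,
          ‖f k x‖ₑ * (‖F x‖ₑ + ENNReal.ofReal ((1 + Fintype.card ι) * η)) ∂H := by
        refine (lintegral_finsetSum' _ fun k _ => ?_).symm
        exact (hf1 k).continuous.enorm.measurable.aemeasurable.mul (hm.add_const _)
      _ = ∫⁻ x in frontier Ω, (‖F x‖ₑ + ENNReal.ofReal ((1 + Fintype.card ι) * η)) ∂H := by
        refine setLIntegral_congr_fun hfrm fun x hx => ?_
        rw [← Finset.sum_mul]
        have h1 : ∑ k ∈ T, ‖f k x‖ₑ = 1 := by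
          have h2 := hfs x (frontier_subset_closure hx)
          simp only [fun k => Real.enorm_of_nonneg (hf0 k x)]
          rw [← ENNReal.ofReal_sum_of_nonneg fun k _ => hf0 k x, h2, ENNReal.ofReal_one]
        rw [h1, one_mul]
      _ = _ := by
        rw [lintegral_add_right _ measurable_const, setLIntegral_const]
  refine ENNReal.le_of_forall_pos_le_add fun ε hε _ => ?_
  -- This choice makes the error term at `η = ε / A` at most `ε`; the summand `1` keeps `A` positive
  -- when the frontier is null.
  set A : ℝ := (1 + Fintype.card ι) * (1 + (H (frontier Ω)).toReal)
  have hA : 0 < A := by positivity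
  refine (key (ε / A) (by positivity)).trans ?_
  gcongr
  rw [← ENNReal.ofReal_toReal hfin, ← ENNReal.ofReal_mul (by positivity),
    ENNReal.ofReal_le_iff_le_toReal (by simp)]
  simp only [ENNReal.coe_toReal]
  have h3 : (1 + (Fintype.card ι : ℝ)) * (ε / A) * (H (frontier Ω)).toReal
      = ε * ((H (frontier Ω)).toReal / (1 + (H (frontier Ω)).toReal)) := by
    simp only [A]
    field_simp
  rw [h3]
  refine mul_le_of_le_one_right ε.2 ?_
  rw [div_le_one (by positivity)]
  linarith

end

/-! ### Geometry of Lipschitz graphs -/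

section

variable {V : Type*} [NormedAddCommGroup V] [InnerProductSpace ℝ V]

/-- Points of the frontier of an open set that is locally a strict subgraph lie on the graph. -/
theorem inner_eq_of_mem_frontier_of_subgraph {Ω : Set V} (hΩ : IsOpen Ω) {ν x : V} {γ : V → ℝ}
    (hγ : Continuous γ) {ε : ℝ}
    (h : ∀ y ∈ Metric.ball x ε, (y ∈ Ω ↔ inner ℝ ν y < γ (y - (inner ℝ ν y : ℝ) • ν)))
    {y : V} (hy : y ∈ frontier Ω) (hyb : y ∈ Metric.ball x ε) :
    inner ℝ ν y = γ (y - (inner ℝ ν y : ℝ) • ν) := by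
  have hyΩ : y ∉ Ω := by
    rw [hΩ.frontier_eq] at hy
    exact hy.2
  refine le_antisymm ?_ (not_lt.1 fun hlt => hyΩ ((h y hyb).2 hlt))
  by_contra! hlt
  have hopen : IsOpen {z | γ (z - (inner ℝ ν z : ℝ) • ν) < inner ℝ ν z} :=
    isOpen_lt (by fun_prop) (by fun_prop)
  obtain ⟨z, ⟨hz1, hz2⟩, hz3⟩ := mem_closure_iff.1 (frontier_subset_closure hy) _
    (hopen.inter Metric.isOpen_ball) ⟨hlt, hyb⟩
  exact lt_asymm hz1 ((h z hz2).1 hz3)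

/-- An open set has unique derivatives at a boundary point near which it is the region below a
Lipschitz graph. -/
theorem uniqueDiffWithinAt_of_subgraph {Ω : Set V} (hΩ : IsOpen Ω) {ν x : V} (hν : ‖ν‖ = 1)
    {K : ℝ≥0} {γ : V → ℝ} (hγ : LipschitzWith K γ) {ε : ℝ} (hε : 0 < ε)
    (h : ∀ y ∈ Metric.ball x ε, (y ∈ Ω ↔ inner ℝ ν y < γ (y - (inner ℝ ν y : ℝ) • ν)))
    (hx : x ∈ frontier Ω) : UniqueDiffWithinAt ℝ Ω x := by
  have hxγ := inner_eq_of_mem_frontier_of_subgraph hΩ hγ.continuous h hx (Metric.mem_ball_self hε)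
  have hνν : inner ℝ ν ν = (1 : ℝ) := by rw [real_inner_self_eq_norm_sq, hν]; norm_num
  let P : V →ₗ[ℝ] V := LinearMap.id - ((innerSL ℝ ν).toLinearMap.smulRight ν)
  have hP : ∀ z, P z = z - (inner ℝ ν z : ℝ) • ν := fun z => by simp [P]
  let q : V → ℝ := fun z => inner ℝ ν z + K * ‖P z‖
  have hqc : Continuous q := by
    simp only [q, hP]; fun_prop
  have hq : ConvexOn ℝ univ q := by
    refine ((innerSL ℝ ν).toLinearMap.convexOn convex_univ).add ?_
    exact (convexOn_univ_norm.comp_linearMap P).smul K.2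
  -- A truncated open cone with vertex `x`, axis `-ν` and slope `K`. It stays below the graph
  -- because `γ` falls by at most `K` per unit of horizontal distance. Being convex with nonempty
  -- interior and having `x` in its closure, it determines derivatives at `x`.
  let C : Set V := (fun y => y - x) ⁻¹' ({z | z ∈ univ ∧ q z < 0} ∩ Metric.ball 0 ε)
  have hCo : IsOpen C := by
    refine IsOpen.preimage (by fun_prop) (IsOpen.inter ?_ Metric.isOpen_ball)
    simpa using isOpen_lt hqc continuous_const
  have hCc : Convex ℝ C := by
    have h1 := ((hq.convex_lt 0).inter (convex_ball (0 : V) ε))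
    simpa [C, sub_eq_add_neg] using h1.translate_preimage_left (-x)
  have hCΩ : C ⊆ Ω := by
    rintro y ⟨⟨-, hy1⟩, hy2⟩
    have hyb : y ∈ Metric.ball x ε := by
      rw [mem_ball_iff_norm]
      simpa using hy2
    rw [h y hyb]
    have h1 := hγ.dist_le_mul (x - (inner ℝ ν x : ℝ) • ν) (y - (inner ℝ ν y : ℝ) • ν)
    rw [← hP, ← hP, dist_comm (P x), dist_eq_norm (P y), ← map_sub, hP x, hP y, ← hxγ,
      Real.dist_eq] at h1
    have h2 := (abs_le.1 h1).2
    simp only [q, inner_sub_right] at hy1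
    linarith
  have htC : ∀ t : ℝ, 0 < t → t < ε → x - t • ν ∈ C := by
    intro t ht htε
    refine ⟨⟨trivial, ?_⟩, ?_⟩
    · simp [q, hP, inner_smul_right, ht, hν]
    · simp [norm_smul, hν, abs_of_pos ht, htε]
  have hxC : x ∈ closure C := by
    have h1 : Filter.Tendsto (fun t : ℝ => x - t • ν) (nhdsWithin 0 (Ioi 0)) (nhds x) := by
      have : Continuous fun t : ℝ => x - t • ν := by fun_prop
      simpa using (this.tendsto 0).mono_left nhdsWithin_le_nhds
    refine mem_closure_of_tendsto h1 ?_
    filter_upwards [Ioo_mem_nhdsGT hε] with t ht using htC t ht.1 ht.2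
  refine (uniqueDiffWithinAt_convex hCc ?_ hxC).mono hCΩ
  rw [hCo.interior_eq]
  exact ⟨_, htC (ε / 2) (by positivity) (by linarith)⟩

open Module in
/-- A bounded piece of a Lipschitz graph has finite surface measure. -/
theorem euclideanHausdorffMeasure_graph_lt_top [FiniteDimensional ℝ V] [MeasurableSpace V]
    [BorelSpace V] {ν : V} (hν : ‖ν‖ = 1) {K : ℝ≥0} {γ : V → ℝ}
    (hγ : LipschitzWith K γ) {A : Set V} (hA : Bornology.IsBounded A)
    (h : ∀ y ∈ A, inner ℝ ν y = γ (y - (inner ℝ ν y : ℝ) • ν)) :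
    (Measure.euclideanHausdorffMeasure (finrank ℝ V - 1) : Measure V) A < ∞ := by
  set W := (ℝ ∙ ν)ᗮ
  obtain ⟨R, hR⟩ := hA.exists_norm_le
  let Γ : W → V := fun p => (p : V) + γ p • ν
  have hΓ : LipschitzWith (1 + K) Γ := by
    refine (LipschitzWith.subtype_val _).add ?_
    refine LipschitzWith.of_dist_le_mul fun p p' => ?_
    rw [dist_eq_norm, ← sub_smul, norm_smul, hν, mul_one, ← dist_eq_norm]
    exact hγ.dist_le_mul _ _
  -- The horizontal part of `y` has norm at most `‖y‖ + |⟪ν, y⟫| ≤ R + R`.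
  have hAΓ : A ⊆ Γ '' Metric.closedBall 0 (R + R) := by
    intro y hy
    have hνν : inner ℝ ν ν = (1 : ℝ) := by rw [real_inner_self_eq_norm_sq, hν]; norm_num
    have hW : y - (inner ℝ ν y : ℝ) • ν ∈ W := by
      rw [Submodule.mem_orthogonal_singleton_iff_inner_right, inner_sub_right, inner_smul_right, hνν]
      ring
    refine ⟨⟨_, hW⟩, ?_, ?_⟩
    · rw [mem_closedBall_zero_iff]
      refine (norm_sub_le _ _).trans (add_le_add (hR y hy) ?_)
      rw [norm_smul, hν, mul_one]
      refine (norm_inner_le_norm ν y).trans ?_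
      rw [hν, one_mul]
      exact hR y hy
    · simp only [Γ, ← h y hy, sub_add_cancel]
  have hvol : (Measure.euclideanHausdorffMeasure (finrank ℝ V - 1) : Measure W) = volume := by
    rw [← finrank_orthogonal_span_unit hν]
    exact InnerProductSpace.euclideanHausdorffMeasure_eq_volume
  refine lt_of_le_of_lt (measure_mono hAΓ) ?_
  have h1 := hΓ.hausdorffMeasure_image_le (d := ((finrank ℝ V - 1 : ℕ) : ℝ)) (by positivity)
    (Metric.closedBall 0 (R + R))
  have h2 : (volume : Measure W) (Metric.closedBall 0 (R + R)) < ∞ :=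
    measure_closedBall_lt_top
  rw [← hvol] at h2
  simp only [Measure.euclideanHausdorffMeasure_def, Measure.smul_apply, ENNReal.smul_def,
    smul_eq_mul] at h2 ⊢
  refine lt_of_le_of_lt (mul_le_mul_right h1 _) ?_
  rw [mul_left_comm]
  exact ENNReal.mul_lt_top (ENNReal.rpow_lt_top_of_nonneg (by positivity) (by simp)) h2

end

/-! ### Lipschitz domains and derivatives on the closed cylinder -/

namespace WavePINN

variable {d : ℕ} {Ω : Set (EuclideanSpace ℝ (Fin d))}

/-- This makes derivatives within the closed cylinder unique, so a function that is `C²` there has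
first and second derivatives continuous up to the boundary. -/
theorem IsLipschitzDomain.uniqueDiffOn_closure (hΩ : IsLipschitzDomain Ω) :
    UniqueDiffOn ℝ (closure Ω) := by
  intro x hx
  by_cases hxΩ : x ∈ Ω
  · exact (hΩ.1.uniqueDiffWithinAt hxΩ).mono subset_closure
  · have hxf : x ∈ frontier Ω := by
      rw [hΩ.1.frontier_eq]
      exact ⟨hx, hxΩ⟩
    obtain ⟨ν, hν, K, γ, hγ, ε, hε, h⟩ := hΩ.2.2 x hxf
    exact (uniqueDiffWithinAt_of_subgraph hΩ.1 hν hγ hε h hxf).mono subset_closure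

theorem IsLipschitzDomain.euclideanHausdorffMeasure_frontier_lt_top (hΩ : IsLipschitzDomain Ω)
    (hb : Bornology.IsBounded Ω) :
    (Measure.euclideanHausdorffMeasure (d - 1) : Measure (EuclideanSpace ℝ (Fin d))) (frontier Ω)
      < ∞ := by
  have hcomp : IsCompact (frontier Ω) :=
    hb.isCompact_closure.of_isClosed_subset isClosed_frontier frontier_subset_closure
  refine hcomp.measure_lt_top_of_nhdsWithin fun x hx => ?_
  obtain ⟨ν, hν, K, γ, hγ, ε, hε, h⟩ := hΩ.2.2 x hx
  refine ⟨frontier Ω ∩ Metric.ball x ε,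
    Filter.inter_mem self_mem_nhdsWithin (mem_nhdsWithin_of_mem_nhds (Metric.ball_mem_nhds x hε)), ?_⟩
  have h1 := euclideanHausdorffMeasure_graph_lt_top hν hγ
    (Metric.isBounded_ball.subset (inter_subset_right (s := frontier Ω) (t := Metric.ball x ε)))
    (fun y hy => inner_eq_of_mem_frontier_of_subgraph hΩ.1 hγ.continuous h hy.1 hy.2)
  simpa using h1

variable {d : ℕ} {Ω : Set (EuclideanSpace ℝ (Fin d))} {T : ℝ}

theorem IsLipschitzDomain.uniqueDiffOn_cylinder (hΩ : IsLipschitzDomain Ω) (hT : 0 < T) :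
    UniqueDiffOn ℝ (cylinder (closure Ω) T) :=
  hΩ.uniqueDiffOn_closure.prod (uniqueDiffOn_Icc hT)

theorem isCompact_cylinder_closure (hb : Bornology.IsBounded Ω) :
    IsCompact (cylinder (closure Ω) T) :=
  hb.isCompact_closure.prod isCompact_Icc

theorem cylinder_mem_nhds (hΩ : IsOpen Ω) {x : EuclideanSpace ℝ (Fin d)} {t : ℝ} (hx : x ∈ Ω)
    (ht : t ∈ Ioo 0 T) : cylinder (closure Ω) T ∈ nhds (x, t) :=
  prod_mem_nhds (Filter.mem_of_superset (hΩ.mem_nhds hx) subset_closure) (Icc_mem_nhds ht.1 ht.2)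

section slices

variable {F : Type*} [NormedAddCommGroup F] [NormedSpace ℝ F]
  {g : EuclideanSpace ℝ (Fin d) × ℝ → F} {A : EuclideanSpace ℝ (Fin d) × ℝ →L[ℝ] F}
  {x : EuclideanSpace ℝ (Fin d)} {t : ℝ}

theorem hasDerivWithinAt_time (hx : x ∈ closure Ω)
    (hg : HasFDerivWithinAt g A (cylinder (closure Ω) T) (x, t)) :
    HasDerivWithinAt (fun s => g (x, s)) (A (0, 1)) (Icc 0 T) t := by
  have h1 : HasDerivWithinAt (fun s : ℝ => (x, s)) (0, 1) (Icc 0 T) t :=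
    (hasDerivWithinAt_const t _ x).prodMk (hasDerivWithinAt_id t _)
  exact hg.comp_hasDerivWithinAt t h1 fun s hs => ⟨hx, hs⟩

theorem hasFDerivAt_space (hΩ : IsOpen Ω) (hx : x ∈ Ω) (ht : t ∈ Icc 0 T)
    (hg : HasFDerivWithinAt g A (cylinder (closure Ω) T) (x, t)) :
    HasFDerivAt (fun y => g (y, t))
      (A.comp (ContinuousLinearMap.inl ℝ (EuclideanSpace ℝ (Fin d)) ℝ)) x := by
  have h1 : HasFDerivWithinAt (fun y : EuclideanSpace ℝ (Fin d) => (y, t))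
      (ContinuousLinearMap.inl ℝ (EuclideanSpace ℝ (Fin d)) ℝ) Ω x :=
    (hasFDerivAt_prodMk_left x t).hasFDerivWithinAt
  have h2 : MapsTo (fun y : EuclideanSpace ℝ (Fin d) => (y, t)) Ω (cylinder (closure Ω) T) :=
    fun y hy => ⟨subset_closure hy, ht⟩
  exact (HasFDerivWithinAt.comp x hg h1 h2).hasFDerivAt (hΩ.mem_nhds hx)

end slices

/-- The derivative of a function on the closed cylinder. -/
noncomputable def cylDeriv (Ω : Set (EuclideanSpace ℝ (Fin d))) (T : ℝ)
    (w : EuclideanSpace ℝ (Fin d) × ℝ → ℝ) :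
    EuclideanSpace ℝ (Fin d) × ℝ → EuclideanSpace ℝ (Fin d) × ℝ →L[ℝ] ℝ :=
  fderivWithin ℝ w (cylinder (closure Ω) T)

/-- The second derivative of a function on the closed cylinder. -/
noncomputable def cylDeriv2 (Ω : Set (EuclideanSpace ℝ (Fin d))) (T : ℝ)
    (w : EuclideanSpace ℝ (Fin d) × ℝ → ℝ) : EuclideanSpace ℝ (Fin d) × ℝ →
      EuclideanSpace ℝ (Fin d) × ℝ →L[ℝ] EuclideanSpace ℝ (Fin d) × ℝ →L[ℝ] ℝ :=
  fderivWithin ℝ (cylDeriv Ω T w) (cylinder (closure Ω) T)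

/-- The spatial gradient of a function on the closed cylinder. -/
noncomputable def cylGrad (Ω : Set (EuclideanSpace ℝ (Fin d))) (T : ℝ)
    (w : EuclideanSpace ℝ (Fin d) × ℝ → ℝ) (z : EuclideanSpace ℝ (Fin d) × ℝ) :
    EuclideanSpace ℝ (Fin d) :=
  (InnerProductSpace.toDual ℝ (EuclideanSpace ℝ (Fin d))).symm
    ((cylDeriv Ω T w z).comp (ContinuousLinearMap.inl ℝ (EuclideanSpace ℝ (Fin d)) ℝ))

section

variable (hΩ : IsLipschitzDomain Ω) (hT : 0 < T) {w : EuclideanSpace ℝ (Fin d) × ℝ → ℝ}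
  (hw : ContDiffOn ℝ 2 w (cylinder (closure Ω) T))
  {x : EuclideanSpace ℝ (Fin d)} {t : ℝ} {z : EuclideanSpace ℝ (Fin d) × ℝ}

include hΩ hT hw

theorem contDiffOn_cylDeriv : ContDiffOn ℝ 1 (cylDeriv Ω T w) (cylinder (closure Ω) T) :=
  hw.fderivWithin (hΩ.uniqueDiffOn_cylinder hT) (by norm_num)

theorem continuousOn_cylDeriv : ContinuousOn (cylDeriv Ω T w) (cylinder (closure Ω) T) :=
  (contDiffOn_cylDeriv hΩ hT hw).continuousOn

theorem continuousOn_cylDeriv2 : ContinuousOn (cylDeriv2 Ω T w) (cylinder (closure Ω) T) :=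
  (contDiffOn_cylDeriv hΩ hT hw).continuousOn_fderivWithin (hΩ.uniqueDiffOn_cylinder hT) le_rfl

theorem continuousOn_cylGrad : ContinuousOn (cylGrad Ω T w) (cylinder (closure Ω) T) := by
  refine (LinearIsometryEquiv.continuous _).comp_continuousOn ?_
  exact (continuousOn_cylDeriv hΩ hT hw).clm_comp continuousOn_const

omit hΩ hT in
theorem hasFDerivWithinAt_cylDeriv (hz : z ∈ cylinder (closure Ω) T) :
    HasFDerivWithinAt w (cylDeriv Ω T w z) (cylinder (closure Ω) T) z :=
  (hw.differentiableOn (by norm_num) z hz).hasFDerivWithinAt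

theorem hasFDerivWithinAt_cylDeriv2 (hz : z ∈ cylinder (closure Ω) T) :
    HasFDerivWithinAt (cylDeriv Ω T w) (cylDeriv2 Ω T w z) (cylinder (closure Ω) T) z :=
  ((contDiffOn_cylDeriv hΩ hT hw).differentiableOn one_ne_zero z hz).hasFDerivWithinAt

omit hΩ in
theorem timeDeriv_eq_cylDeriv (hz : z ∈ cylinder (closure Ω) T) :
    timeDeriv T w z = cylDeriv Ω T w z (0, 1) :=
  (hasDerivWithinAt_time hz.1 (hasFDerivWithinAt_cylDeriv hw hz)).derivWithin
    (uniqueDiffOn_Icc hT z.2 hz.2)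

theorem timeDeriv_timeDeriv_eq_cylDeriv2 (hz : z ∈ cylinder (closure Ω) T) :
    timeDeriv T (timeDeriv T w) z = cylDeriv2 Ω T w z (0, 1) (0, 1) := by
  have h1 : HasDerivWithinAt (fun s => cylDeriv Ω T w (z.1, s) (0, 1))
      (cylDeriv2 Ω T w z (0, 1) (0, 1)) (Icc 0 T) z.2 := by
    have := (hasDerivWithinAt_time hz.1 (hasFDerivWithinAt_cylDeriv2 hΩ hT hw hz)).clm_apply
      (hasDerivWithinAt_const z.2 _ ((0, 1) : EuclideanSpace ℝ (Fin d) × ℝ))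
    simpa using this
  rw [← h1.derivWithin (uniqueDiffOn_Icc hT z.2 hz.2)]
  exact derivWithin_congr (fun s hs => timeDeriv_eq_cylDeriv hT hw ⟨hz.1, hs⟩)
    (timeDeriv_eq_cylDeriv hT hw hz)

-- The equality is confined to `x ∈ Ω`: at frontier points the two-sided `gradient` need not exist,
-- whereas `cylGrad` is continuous up to the boundary and serves there in its place.
omit hT in
theorem spaceGrad_eq_cylGrad (hx : x ∈ Ω) (ht : t ∈ Icc 0 T) :
    spaceGrad w (x, t) = cylGrad Ω T w (x, t) := by
  have h1 := hasFDerivAt_space hΩ.1 hx ht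
    (hasFDerivWithinAt_cylDeriv hw (z := (x, t)) ⟨subset_closure hx, ht⟩)
  simp only [spaceGrad, gradient, cylGrad]
  rw [h1.fderiv]

theorem spaceLaplacian_eq_cylDeriv2 (hx : x ∈ Ω) (ht : t ∈ Icc 0 T) :
    spaceLaplacian w (x, t) = ∑ i, cylDeriv2 Ω T w (x, t) (EuclideanSpace.basisFun (Fin d) ℝ i, 0)
      (EuclideanSpace.basisFun (Fin d) ℝ i, 0) := by
  simp only [spaceLaplacian]
  rw [InnerProductSpace.laplacian_eq_iteratedFDeriv_orthonormalBasis _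
    (EuclideanSpace.basisFun (Fin d) ℝ)]
  refine Finset.sum_congr rfl fun i _ => ?_
  rw [iteratedFDeriv_two_apply]
  have h1 : fderiv ℝ (fun y => w (y, t)) =ᶠ[nhds x] fun y => (cylDeriv Ω T w (y, t)).comp
      (ContinuousLinearMap.inl ℝ (EuclideanSpace ℝ (Fin d)) ℝ) := by
    filter_upwards [hΩ.1.mem_nhds hx] with y hy
    exact (hasFDerivAt_space hΩ.1 hy ht
      (hasFDerivWithinAt_cylDeriv hw (z := (y, t)) ⟨subset_closure hy, ht⟩)).fderiv
  have h2 := (hasFDerivAt_space hΩ.1 hx ht (hasFDerivWithinAt_cylDeriv2 hΩ hT hw (z := (x, t))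
    ⟨subset_closure hx, ht⟩)).clm_comp
      (hasFDerivAt_const (ContinuousLinearMap.inl ℝ (EuclideanSpace ℝ (Fin d)) ℝ) x)
  rw [h1.fderiv_eq, h2.fderiv]
  simp

/-- Interior times are required so that the cylinder is a neighbourhood of the point and the
derivatives are two-sided. -/
theorem cylDeriv2_symm (hx : x ∈ Ω) (ht : t ∈ Ioo 0 T) (p q : EuclideanSpace ℝ (Fin d) × ℝ) :
    cylDeriv2 Ω T w (x, t) p q = cylDeriv2 Ω T w (x, t) q p := by
  have hnhds : ∀ᶠ z in nhds (x, t), z ∈ Ω ×ˢ Ioo 0 T :=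
    (hΩ.1.prod isOpen_Ioo).mem_nhds ⟨hx, ht⟩
  have h1 : ∀ᶠ z in nhds (x, t), HasFDerivAt w (cylDeriv Ω T w z) z := by
    filter_upwards [hnhds] with z hz
    exact (hasFDerivWithinAt_cylDeriv hw ⟨subset_closure hz.1, Ioo_subset_Icc_self hz.2⟩).hasFDerivAt
      (cylinder_mem_nhds hΩ.1 hz.1 hz.2)
  have h2 : HasFDerivAt (cylDeriv Ω T w) (cylDeriv2 Ω T w (x, t)) (x, t) :=
    (hasFDerivWithinAt_cylDeriv2 hΩ hT hw ⟨subset_closure hx, Ioo_subset_Icc_self ht⟩).hasFDerivAt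
      (cylinder_mem_nhds hΩ.1 hx ht)
  exact second_derivative_symmetric_of_eventually h1 h2 p q

end

/-! ### Growth of the nonlinearity -/

variable {d : ℕ} {Ω : Set (EuclideanSpace ℝ (Fin d))}

/-- Increments of a function whose derivative has growth of order `r`. -/
theorem abs_sub_le_of_abs_deriv_le_rpow {φ φ' : ℝ → ℝ} {c r : ℝ} (hc : 0 ≤ c) (hr : 1 ≤ r)
    (hd : ∀ s, HasDerivAt φ (φ' s) s) (hb : ∀ s, |φ' s| ≤ c * |s| ^ r) (p q : ℝ) :
    |φ (p + q) - φ p| ≤ 2 ^ (r - 1) * c * (|p| ^ r + 1 / (r + 1) * |q| ^ r) * |q| := by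
  have hr0 : 0 ≤ r := by linarith
  -- `B` is the primitive of `B'`, which bounds the derivative of `s ↦ φ (p + s q)` through `(x +
  -- y)^r ≤ 2^(r-1) (x^r + y^r)`. Integrating `s^r` over `[0,1]` produces the factor `1 / (r + 1)`.
  let B : ℝ → ℝ := fun s => 2 ^ (r - 1) * c * (|p| ^ r * s + 1 / (r + 1) * |q| ^ r * s ^ (r + 1)) * |q|
  let B' : ℝ → ℝ := fun s => 2 ^ (r - 1) * c * (|p| ^ r + |q| ^ r * s ^ r) * |q|
  have hB : ∀ s, HasDerivAt B (B' s) s := by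
    intro s
    have h1 : HasDerivAt (fun s : ℝ => s ^ (r + 1)) ((r + 1) * s ^ r) s := by
      simpa using Real.hasDerivAt_rpow_const (x := s) (p := r + 1) (Or.inr (by linarith))
    have h2 := ((((hasDerivAt_id s).const_mul (|p| ^ r)).add
      (h1.const_mul (1 / (r + 1) * |q| ^ r))).const_mul (2 ^ (r - 1) * c)).mul_const |q|
    refine h2.congr_deriv ?_
    simp only [B']
    field_simp
  have hψ : ∀ s, HasDerivAt (fun s => φ (p + s * q) - φ p) (φ' (p + s * q) * q) s := by
    intro s
    have h1 : HasDerivAt (fun s : ℝ => p + s * q) q s := by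
      simpa using ((hasDerivAt_id s).mul_const q).const_add p
    exact ((hd _).comp s h1).sub_const _
  have hbound : ∀ s ∈ Ico (0 : ℝ) 1, ‖φ' (p + s * q) * q‖ ≤ B' s := by
    intro s hs
    rw [norm_mul, Real.norm_eq_abs, Real.norm_eq_abs]
    refine mul_le_mul_of_nonneg_right ?_ (abs_nonneg _)
    refine (hb _).trans ?_
    rw [mul_comm (2 ^ (r - 1)) c, mul_assoc]
    refine mul_le_mul_of_nonneg_left ?_ hc
    calc |p + s * q| ^ r ≤ (|p| + s * |q|) ^ r := by
          refine Real.rpow_le_rpow (abs_nonneg _) ?_ hr0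
          refine (abs_add_le _ _).trans ?_
          rw [abs_mul, abs_of_nonneg hs.1]
      _ ≤ 2 ^ (r - 1) * (|p| ^ r + (s * |q|) ^ r) := by
          exact_mod_cast NNReal.rpow_add_le_mul_rpow_add_rpow ⟨|p|, abs_nonneg p⟩
            ⟨s * |q|, mul_nonneg hs.1 (abs_nonneg q)⟩ hr
      _ = _ := by
          rw [Real.mul_rpow hs.1 (abs_nonneg _)]
          ring
  have h := image_norm_le_of_norm_deriv_right_le_deriv_boundary (a := 0) (b := 1)
    (f := fun s => φ (p + s * q) - φ p) (f' := fun s => φ' (p + s * q) * q)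
    (fun s _ => (hψ s).continuousAt.continuousWithinAt) (fun s _ => (hψ s).hasDerivWithinAt)
    (B := B) (B' := B') (by simp [B, Real.zero_rpow (show r + 1 ≠ 0 by linarith)]) hB hbound
    (right_mem_Icc.2 zero_le_one)
  simpa [B] using h

theorem AssumptionA2.abs_sub_le {f : EuclideanSpace ℝ (Fin d) × ℝ → ℝ} {k : ℕ} {c r : ℝ}
    (hΩ : IsLipschitzDomain Ω) (hf : AssumptionA2 Ω f k c r) {x : EuclideanSpace ℝ (Fin d)}
    (hx : x ∈ closure Ω) (p q : ℝ) :
    |f (x, p + q) - f (x, p)| ≤ 2 ^ (r - 1) * c * (|p| ^ r + 1 / (r + 1) * |q| ^ r) * |q| := by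
  obtain ⟨hk, hc, hr, -, -, hcd, hbd⟩ := hf
  have hU : UniqueDiffOn ℝ (closure Ω ×ˢ (univ : Set ℝ)) :=
    hΩ.uniqueDiffOn_closure.prod uniqueDiffOn_univ
  refine abs_sub_le_of_abs_deriv_le_rpow (φ := fun s => f (x, s))
    (φ' := fun s => fderivWithin ℝ f (closure Ω ×ˢ univ) (x, s) (0, 1)) hc.le hr
    (fun s => ?_) (fun s => ?_) p q
  · have h1 : HasFDerivWithinAt f (fderivWithin ℝ f (closure Ω ×ˢ univ) (x, s)) (closure Ω ×ˢ univ)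
        (x, s) := by
      refine (hcd.differentiableOn ?_ (x, s) ⟨hx, trivial⟩).hasFDerivWithinAt
      have : k - 1 ≠ 0 := by omega
      exact_mod_cast this
    have h2 : HasDerivWithinAt (fun s : ℝ => (x, s)) (0, 1) univ s :=
      (hasDerivWithinAt_const s _ x).prodMk (hasDerivWithinAt_id s _)
    have h3 := h1.comp_hasDerivWithinAt s h2 fun s _ => ⟨hx, trivial⟩
    exact hasDerivWithinAt_univ.1 h3
  -- The growth condition is applied with `i = 0`, `j = 1`, where the exponent is `r`.
  · have h1 := hbd 0 1 (by omega) Fin.elim0 x hx s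
    rw [iteratedFDerivWithin_one_apply (hU (x, s) ⟨hx, trivial⟩)] at h1
    have h2 : max (r + 1 - ((1 : ℕ) : ℝ)) 0 = r := by
      rw [Nat.cast_one, add_sub_cancel_right]
      exact max_eq_left (by linarith)
    rw [h2] at h1
    exact h1

end WavePINN

/-! ### Integration over the space-time cylinder -/

/-- A real integral is at most the integral of the positive part. -/
theorem integral_le_toReal_lintegral_ofReal {α : Type*} [MeasurableSpace α] {μ : Measure α}
    {f : α → ℝ} (hf : Integrable f μ) {c : ℝ≥0∞} (hc : c ≠ ∞)
    (h : ∫⁻ x, ENNReal.ofReal (f x) ∂μ ≤ c) : ∫ x, f x ∂μ ≤ c.toReal := by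
  rw [integral_eq_lintegral_pos_part_sub_lintegral_neg_part hf]
  have h1 := ENNReal.toReal_mono hc h
  have h2 : 0 ≤ (∫⁻ x, ENNReal.ofReal (-f x) ∂μ).toReal := ENNReal.toReal_nonneg
  linarith

theorem continuousOn_smulRight {X E F : Type*} [TopologicalSpace X] [NormedAddCommGroup E]
    [NormedSpace ℝ E] [NormedAddCommGroup F] [NormedSpace ℝ F] {s : Set X} {A : X → E →L[ℝ] ℝ}
    {v : X → F} (hA : ContinuousOn A s) (hv : ContinuousOn v s) :
    ContinuousOn (fun x => (A x).smulRight (v x)) s := by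
  have h1 : ContinuousOn (fun x => ContinuousLinearMap.smulRightL ℝ E F (A x)) s :=
    (ContinuousLinearMap.smulRightL ℝ E F).continuous.comp_continuousOn hA
  exact h1.clm_apply hv

namespace WavePINN

variable {d : ℕ} {Ω : Set (EuclideanSpace ℝ (Fin d))} {T : ℝ}

theorem volume_restrict_cylinder (I : Set ℝ) :
    (volume : Measure (EuclideanSpace ℝ (Fin d) × ℝ)).restrict (Ω ×ˢ I)
      = (volume.restrict Ω).prod (volume.restrict I) := by
  rw [Measure.volume_eq_prod, Measure.prod_restrict]

section

variable (hΩ : IsOpen Ω) (hb : Bornology.IsBounded Ω) {g : EuclideanSpace ℝ (Fin d) × ℝ → ℝ}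
  (hg : ContinuousOn g (cylinder (closure Ω) T))

include hb hg in
theorem integrable_prod_of_continuousOn {I : Set ℝ} (hI : I ⊆ Icc 0 T) :
    Integrable g ((volume.restrict Ω).prod (volume.restrict I)) := by
  rw [← volume_restrict_cylinder]
  exact (hg.integrableOn_compact (isCompact_cylinder_closure hb)).mono_set
    (prod_mono subset_closure hI)

include hb hg in
theorem integrableOn_slice {t : ℝ} (ht : t ∈ Icc 0 T) : IntegrableOn (fun x => g (x, t)) Ω := by
  have h1 : ContinuousOn (fun x => g (x, t)) (closure Ω) :=
    hg.comp (by fun_prop) fun x hx => ⟨hx, ht⟩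
  exact (h1.integrableOn_compact hb.isCompact_closure).mono_set subset_closure

include hΩ hb hg in
theorem continuousOn_setIntegral_slice :
    ContinuousOn (fun t => ∫ x in Ω, g (x, t)) (Icc 0 T) := by
  obtain ⟨C, hC⟩ := (isCompact_cylinder_closure (T := T) hb).exists_bound_of_continuousOn hg
  refine continuousOn_of_dominated (bound := fun _ => C)
    (fun t ht => (integrableOn_slice hb hg ht).aestronglyMeasurable) (fun t ht => ?_) ?_ ?_
  · filter_upwards [ae_restrict_mem hΩ.measurableSet] with x hx using hC _ ⟨subset_closure hx, ht⟩
  · exact integrableOn_const (lt_of_le_of_lt (measure_mono subset_closure)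
      hb.isCompact_closure.measure_lt_top).ne
  · filter_upwards [ae_restrict_mem hΩ.measurableSet] with x hx
    exact hg.comp (by fun_prop) fun t ht => ⟨subset_closure hx, ht⟩

include hΩ hb hg in
theorem intervalIntegrable_setIntegral_slice {t : ℝ} (ht : t ∈ Icc 0 T) :
    IntervalIntegrable (fun s => ∫ x in Ω, g (x, s)) volume 0 t :=
  ((continuousOn_setIntegral_slice hΩ hb hg).mono
    (Icc_subset_Icc_right ht.2)).intervalIntegrable_of_Icc ht.1

include hb hg in
theorem intervalIntegral_setIntegral_eq {t : ℝ} (ht : t ∈ Icc 0 T) :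
    ∫ s in (0 : ℝ)..t, ∫ x in Ω, g (x, s)
      = ∫ z, g z ∂((volume.restrict Ω).prod (volume.restrict (Ioc 0 t))) := by
  rw [intervalIntegral.integral_of_le ht.1, integral_prod_symm]
  exact integrable_prod_of_continuousOn hb hg
    ((Ioc_subset_Icc_self).trans (Icc_subset_Icc_right ht.2))

-- The fundamental theorem of calculus on each vertical segment, followed by Fubini; this replaces
-- differentiation under the integral sign.
include hΩ hb hg in
theorem setIntegral_slice_eq_add {g' : EuclideanSpace ℝ (Fin d) × ℝ → ℝ}
    (hg' : ContinuousOn g' (cylinder (closure Ω) T))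
    (hd : ∀ x ∈ Ω, ∀ t ∈ Icc 0 T, HasDerivWithinAt (fun s => g (x, s)) (g' (x, t)) (Icc 0 T) t)
    {t : ℝ} (ht : t ∈ Icc 0 T) :
    ∫ x in Ω, g (x, t) = (∫ x in Ω, g (x, 0)) + ∫ s in (0 : ℝ)..t, ∫ x in Ω, g' (x, s) := by
  have h0 : (0 : ℝ) ∈ Icc 0 T := ⟨le_rfl, ht.1.trans ht.2⟩
  have hint := integrable_prod_of_continuousOn hb hg'
    ((Ioc_subset_Icc_self (a := 0) (b := t)).trans (Icc_subset_Icc_right ht.2))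
  rw [intervalIntegral_setIntegral_eq hb hg' ht, integral_prod _ hint, ← sub_eq_iff_eq_add',
    ← integral_sub (integrableOn_slice hb hg ht) (integrableOn_slice hb hg h0)]
  refine setIntegral_congr_fun hΩ.measurableSet fun x hx => ?_
  have hsub : Icc 0 t ⊆ Icc 0 T := Icc_subset_Icc_right ht.2
  have hc : ContinuousOn (fun s => g (x, s)) (Icc 0 t) :=
    hg.comp (by fun_prop) fun s hs => ⟨subset_closure hx, hsub hs⟩
  have hc' : ContinuousOn (fun s => g' (x, s)) (Icc 0 t) :=
    hg'.comp (by fun_prop) fun s hs => ⟨subset_closure hx, hsub hs⟩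
  rw [← intervalIntegral.integral_of_le ht.1,
    intervalIntegral.integral_eq_sub_of_hasDerivAt_of_le ht.1 hc (fun s hs =>
      (hd x hx s (hsub (Ioo_subset_Icc_self hs))).hasDerivAt
        (Icc_mem_nhds hs.1 (hs.2.trans_le ht.2))) (hc'.intervalIntegrable_of_Icc ht.1)]

-- `R` will be the interior residual, which contains the coefficient `a` and need not be continuous.
-- Only the continuous `g - m` is integrated as a real function; its positive part lies below `R²`,
-- and lower integrals are monotone without measurability of `R`.
include hb hg in
theorem intervalIntegral_setIntegral_le_add_toReal {m R : EuclideanSpace ℝ (Fin d) × ℝ → ℝ}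
    (hm : ContinuousOn m (cylinder (closure Ω) T))
    (hR : ∫⁻ z in cylinder Ω T, ‖R z‖ₑ ^ 2 ≠ ∞)
    (hle : ∀ᵐ x ∂(volume.restrict Ω), ∀ s ∈ Icc 0 T, g (x, s) ≤ R (x, s) ^ 2 + m (x, s))
    {t : ℝ} (ht : t ∈ Icc 0 T) :
    ∫ s in (0 : ℝ)..t, ∫ x in Ω, g (x, s) ≤
      (∫ s in (0 : ℝ)..t, ∫ x in Ω, m (x, s)) + (∫⁻ z in cylinder Ω T, ‖R z‖ₑ ^ 2).toReal := by
  have hI : Ioc 0 t ⊆ Icc 0 T := (Ioc_subset_Icc_self).trans (Icc_subset_Icc_right ht.2)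
  have hgi := integrable_prod_of_continuousOn hb hg hI
  have hmi := integrable_prod_of_continuousOn hb hm hI
  rw [intervalIntegral_setIntegral_eq hb hg ht, intervalIntegral_setIntegral_eq hb hm ht,
    ← sub_le_iff_le_add', ← integral_sub hgi hmi]
  refine integral_le_toReal_lintegral_ofReal (hgi.sub hmi) hR ?_
  rw [← volume_restrict_cylinder]
  refine le_trans ?_ (lintegral_mono_set (prod_mono_right hI))
  refine lintegral_mono_ae ?_
  rw [volume_restrict_cylinder]
  have h1 := (Measure.quasiMeasurePreserving_fst (μ := volume.restrict Ω)
    (ν := volume.restrict (Ioc 0 t))).ae hle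
  have h2 := (Measure.quasiMeasurePreserving_snd (μ := volume.restrict Ω)
    (ν := volume.restrict (Ioc 0 t))).ae (ae_restrict_mem measurableSet_Ioc)
  filter_upwards [h1, h2] with z hz1 hz2
  have h3 := hz1 z.2 (hI hz2)
  rw [← enorm_pow, Real.enorm_of_nonneg (sq_nonneg _)]
  exact ENNReal.ofReal_le_ofReal (sub_le_iff_le_add.2 h3)

end

/-! ### The energy density and its flux -/

section

variable (hΩ : IsLipschitzDomain Ω) (hb : Bornology.IsBounded Ω) (hT : 0 < T)
  {w : EuclideanSpace ℝ (Fin d) × ℝ → ℝ} (hw : ContDiffOn ℝ 2 w (cylinder (closure Ω) T))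

/-- The spatial Laplacian on the closed cylinder. -/
noncomputable def cylLaplacian (Ω : Set (EuclideanSpace ℝ (Fin d))) (T : ℝ)
    (w : EuclideanSpace ℝ (Fin d) × ℝ → ℝ) (z : EuclideanSpace ℝ (Fin d) × ℝ) : ℝ :=
  ∑ i, cylDeriv2 Ω T w z (EuclideanSpace.basisFun (Fin d) ℝ i, 0)
    (EuclideanSpace.basisFun (Fin d) ℝ i, 0)

/-- The spatial divergence of `w_t ∇w`. -/
noncomputable def fluxDivergence (Ω : Set (EuclideanSpace ℝ (Fin d))) (T : ℝ)
    (w : EuclideanSpace ℝ (Fin d) × ℝ → ℝ) (z : EuclideanSpace ℝ (Fin d) × ℝ) : ℝ :=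
  cylDeriv Ω T w z (0, 1) * cylLaplacian Ω T w z + cylDeriv2 Ω T w z (cylGrad Ω T w z, 0) (0, 1)

include hΩ hT hw

theorem continuousOn_cylLaplacian : ContinuousOn (cylLaplacian Ω T w) (cylinder (closure Ω) T) := by
  refine continuousOn_finsetSum _ fun i _ => ?_
  exact ((continuousOn_cylDeriv2 hΩ hT hw).clm_apply continuousOn_const).clm_apply
    continuousOn_const

theorem continuousOn_cylDeriv_time :
    ContinuousOn (fun z => cylDeriv Ω T w z (0, 1)) (cylinder (closure Ω) T) :=
  (continuousOn_cylDeriv hΩ hT hw).clm_apply continuousOn_const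

theorem continuousOn_fluxDivergence :
    ContinuousOn (fluxDivergence Ω T w) (cylinder (closure Ω) T) := by
  refine ((continuousOn_cylDeriv_time hΩ hT hw).mul (continuousOn_cylLaplacian hΩ hT hw)).add ?_
  exact ((continuousOn_cylDeriv2 hΩ hT hw).clm_apply
    ((continuousOn_cylGrad hΩ hT hw).prodMk continuousOn_const)).clm_apply continuousOn_const

theorem hasDerivWithinAt_cylDeriv_time {z : EuclideanSpace ℝ (Fin d) × ℝ}
    (hz : z ∈ cylinder (closure Ω) T) :
    HasDerivWithinAt (fun s => cylDeriv Ω T w (z.1, s) (0, 1)) (cylDeriv2 Ω T w z (0, 1) (0, 1))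
      (Icc 0 T) z.2 := by
  have := (hasDerivWithinAt_time hz.1 (hasFDerivWithinAt_cylDeriv2 hΩ hT hw hz)).clm_apply
    (hasDerivWithinAt_const z.2 _ ((0, 1) : EuclideanSpace ℝ (Fin d) × ℝ))
  simpa using this

/-- The mixed second derivative has its time slot first here and its space slot first in
`fluxDivergence`; `cylDeriv2_symm` later identifies the two. -/
theorem hasDerivWithinAt_energyDensity {z : EuclideanSpace ℝ (Fin d) × ℝ}
    (hz : z ∈ cylinder (closure Ω) T) :
    HasDerivWithinAt (fun s => ‖cylGrad Ω T w (z.1, s)‖ ^ 2 + cylDeriv Ω T w (z.1, s) (0, 1) ^ 2)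
      (2 * cylDeriv2 Ω T w z (0, 1) (cylGrad Ω T w z, 0)
        + 2 * (cylDeriv Ω T w z (0, 1) * cylDeriv2 Ω T w z (0, 1) (0, 1))) (Icc 0 T) z.2 := by
  have h1 := (hasDerivWithinAt_time hz.1 (hasFDerivWithinAt_cylDeriv2 hΩ hT hw hz)).clm_comp
    (hasDerivWithinAt_const z.2 _ (ContinuousLinearMap.inl ℝ (EuclideanSpace ℝ (Fin d)) ℝ))
  have h2 := (((InnerProductSpace.toDual ℝ
    (EuclideanSpace ℝ (Fin d))).symm.toContinuousLinearEquiv.toContinuousLinearMap.hasFDerivAt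
      ).comp_hasDerivWithinAt z.2 h1).norm_sq
  have h3 := (hasDerivWithinAt_cylDeriv_time hΩ hT hw hz).pow 2
  refine (h2.add h3).congr_deriv ?_
  simp only [ContinuousLinearMap.comp_zero, add_zero]
  congr 1
  · rw [real_inner_comm]
    congr 1
    exact InnerProductSpace.toDual_symm_apply
  · simp
    ring

/-- The one-sided divergence theorem for the field `w_t ∇w` on a time slice, whose length is `|w_t|
|∇w|`. -/
theorem enorm_setIntegral_fluxDivergence_le (hb : Bornology.IsBounded Ω) {t : ℝ}
    (ht : t ∈ Icc 0 T) :
    ‖∫ x in Ω, fluxDivergence Ω T w (x, t)‖ₑ ≤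
      ∫⁻ x, ‖cylDeriv Ω T w (x, t) (0, 1)‖ₑ * ‖cylGrad Ω T w (x, t)‖ₑ ∂(surfaceMeasure Ω) := by
  have hfin := (hΩ.euclideanHausdorffMeasure_frontier_lt_top hb).ne
  have hfr : Module.finrank ℝ (EuclideanSpace ℝ (Fin d)) = d := by simp
  have hsl : ContinuousOn (fun x : EuclideanSpace ℝ (Fin d) => (x, t)) (closure Ω) := by fun_prop
  have hmaps : MapsTo (fun x : EuclideanSpace ℝ (Fin d) => (x, t)) (closure Ω)
      (cylinder (closure Ω) T) := fun x hx => ⟨hx, ht⟩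
  let L := (InnerProductSpace.toDual ℝ
    (EuclideanSpace ℝ (Fin d))).symm.toContinuousLinearEquiv.toContinuousLinearMap
  let inl := ContinuousLinearMap.inl ℝ (EuclideanSpace ℝ (Fin d)) ℝ
  let ev : (EuclideanSpace ℝ (Fin d) × ℝ →L[ℝ] ℝ) →L[ℝ] ℝ :=
    ContinuousLinearMap.apply ℝ ℝ ((0, 1) : EuclideanSpace ℝ (Fin d) × ℝ)
  let gr : (EuclideanSpace ℝ (Fin d) × ℝ →L[ℝ] ℝ) →L[ℝ] EuclideanSpace ℝ (Fin d) :=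
    L.comp ((ContinuousLinearMap.compL ℝ (EuclideanSpace ℝ (Fin d))
      (EuclideanSpace ℝ (Fin d) × ℝ) ℝ).flip inl)
  let F' : EuclideanSpace ℝ (Fin d) → EuclideanSpace ℝ (Fin d) →L[ℝ] EuclideanSpace ℝ (Fin d) :=
    fun x => cylDeriv Ω T w (x, t) (0, 1) • (gr.comp ((cylDeriv2 Ω T w (x, t)).comp inl))
      + (ev.comp ((cylDeriv2 Ω T w (x, t)).comp inl)).smulRight (cylGrad Ω T w (x, t))
  have hF : ContinuousOn (fun x => cylDeriv Ω T w (x, t) (0, 1) • cylGrad Ω T w (x, t))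
      (closure Ω) :=
    (((continuousOn_cylDeriv_time hΩ hT hw).smul (continuousOn_cylGrad hΩ hT hw)).comp hsl hmaps)
  have hF'c : ContinuousOn F' (closure Ω) := by
    have h2 : ContinuousOn (fun x => (cylDeriv2 Ω T w (x, t)).comp inl) (closure Ω) :=
      ((continuousOn_cylDeriv2 hΩ hT hw).comp hsl hmaps).clm_comp continuousOn_const
    refine ContinuousOn.add ?_ ?_
    · exact ((continuousOn_cylDeriv_time hΩ hT hw).comp hsl hmaps).smul
        (continuousOn_const.clm_comp h2)
    · have h3 := ((continuousOn_const (c := ev)).clm_comp h2)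
      have h4 := (continuousOn_cylGrad hΩ hT hw).comp hsl hmaps
      exact continuousOn_smulRight h3 h4
  have hd : ∀ x ∈ Ω, HasFDerivAt
      (fun x => cylDeriv Ω T w (x, t) (0, 1) • cylGrad Ω T w (x, t)) (F' x) x := by
    intro x hx
    have h1 := hasFDerivAt_space hΩ.1 hx ht (hasFDerivWithinAt_cylDeriv2 hΩ hT hw (z := (x, t))
      ⟨subset_closure hx, ht⟩)
    exact (ev.hasFDerivAt.comp x h1).smul (gr.hasFDerivAt.comp x h1)
  have h := enorm_setIntegral_divergence_le (EuclideanSpace.basisFun (Fin d) ℝ) hΩ.1 hb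
    (by rw [hfr]; exact hfin) hF hd
    ((hF'c.integrableOn_compact hb.isCompact_closure).mono_set subset_closure)
  rw [hfr] at h
  simp only [enorm_smul] at h
  refine le_trans (le_of_eq ?_) h
  congr 1
  refine setIntegral_congr_fun hΩ.1.measurableSet fun x hx => ?_
  have hgr : ∀ (i : Fin d) (A : EuclideanSpace ℝ (Fin d) × ℝ →L[ℝ] ℝ),
      inner ℝ (EuclideanSpace.basisFun (Fin d) ℝ i) (gr A)
        = A (EuclideanSpace.basisFun (Fin d) ℝ i, 0) := by
    intro i A
    rw [real_inner_comm]
    exact InnerProductSpace.toDual_symm_apply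
  have hsum : cylDeriv2 Ω T w (x, t) (cylGrad Ω T w (x, t), 0) (0, 1)
      = ∑ i, cylDeriv2 Ω T w (x, t) (EuclideanSpace.basisFun (Fin d) ℝ i, 0) (0, 1)
        * inner ℝ (EuclideanSpace.basisFun (Fin d) ℝ i) (cylGrad Ω T w (x, t)) := by
    have h1 : cylDeriv2 Ω T w (x, t) (cylGrad Ω T w (x, t), 0) (0, 1)
        = (ev.comp ((cylDeriv2 Ω T w (x, t)).comp inl)) (cylGrad Ω T w (x, t)) := rfl
    rw [h1]
    conv_lhs => rw [← (EuclideanSpace.basisFun (Fin d) ℝ).sum_repr' (cylGrad Ω T w (x, t))]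
    rw [map_sum]
    refine Finset.sum_congr rfl fun i _ => ?_
    rw [map_smul, smul_eq_mul, mul_comm]
    rfl
  simp only [fluxDivergence]
  rw [hsum, cylLaplacian, Finset.mul_sum, ← Finset.sum_add_distrib]
  refine Finset.sum_congr rfl fun i _ => ?_
  have h5 : F' x (EuclideanSpace.basisFun (Fin d) ℝ i)
      = cylDeriv Ω T w (x, t) (0, 1) • gr (cylDeriv2 Ω T w (x, t)
          (EuclideanSpace.basisFun (Fin d) ℝ i, 0))
        + cylDeriv2 Ω T w (x, t) (EuclideanSpace.basisFun (Fin d) ℝ i, 0) (0, 1)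
          • cylGrad Ω T w (x, t) := rfl
  rw [h5, inner_add_right, inner_smul_right, inner_smul_right, hgr]

end

end WavePINN

/-! ### Gronwall and Cauchy–Schwarz in time -/

/-- An integral form of Gronwall's inequality. -/
theorem intervalIntegral_le_of_le_add_mul_intervalIntegral {h : ℝ → ℝ} {T G lam : ℝ} (hT : 0 ≤ T)
    (hG : 0 ≤ G) (hlam : 0 ≤ lam) (hc : ContinuousOn h (Icc 0 T))
    (hle : ∀ t ∈ Icc 0 T, h t ≤ G + lam * ∫ s in (0 : ℝ)..t, h s) :
    ∫ s in (0 : ℝ)..T, h s ≤ G * T * Real.exp (lam * T) := by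
  have hcH : ContinuousOn (fun t => ∫ s in (0 : ℝ)..t, h s) (Icc 0 T) := by
    have := intervalIntegral.continuousOn_primitive_interval (μ := volume) (f := h) (a := 0)
      (b := T) (by rw [uIcc_of_le hT]; exact hc.integrableOn_Icc)
    rwa [uIcc_of_le hT] at this
  have hdH : ∀ t ∈ Ico 0 T, HasDerivWithinAt (fun t => ∫ s in (0 : ℝ)..t, h s) (h t) (Ici t) t := by
    intro t ht
    have htI : t ∈ Icc 0 T := Ico_subset_Icc_self ht
    have hnhds : Icc 0 T ∈ nhdsWithin t (Ioi t) :=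
      Filter.mem_of_superset (Icc_mem_nhdsGT_of_mem ht) subset_rfl
    refine (intervalIntegral.integral_hasDerivWithinAt_right (t := Ioi t) ?_ ?_ ?_).mono_of_mem_nhdsWithin
      self_mem_nhdsWithin
    · exact (hc.mono (Icc_subset_Icc_right htI.2)).intervalIntegrable_of_Icc htI.1
    · exact ⟨Icc 0 T, hnhds, hc.aestronglyMeasurable measurableSet_Icc⟩
    · exact (hc t htI).mono_of_mem_nhdsWithin hnhds
  -- With `H` the primitive of `h`, the derivative of `exp(-λt) H(t)` is `exp(-λt) (h - λH) ≤ G`, so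
  -- this function stays below `G t`.
  have key := image_le_of_deriv_right_le_deriv_boundary (a := 0) (b := T)
    (f := fun t => Real.exp (-(lam * t)) * ∫ s in (0 : ℝ)..t, h s)
    (f' := fun t => Real.exp (-(lam * t)) * (-lam) * (∫ s in (0 : ℝ)..t, h s)
      + Real.exp (-(lam * t)) * h t)
    (B := fun t => G * t) (B' := fun _ => G) ?_ ?_ (by simp) (by fun_prop) ?_ ?_
    (right_mem_Icc.2 hT)
  · have h1 : ∫ s in (0 : ℝ)..T, h s
        = Real.exp (lam * T) * (Real.exp (-(lam * T)) * ∫ s in (0 : ℝ)..T, h s) := by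
      rw [← mul_assoc, ← Real.exp_add]; simp
    rw [h1, mul_comm (G * T)]
    exact mul_le_mul_of_nonneg_left key (Real.exp_pos _).le
  · exact ContinuousOn.mul (by fun_prop) hcH
  · intro t ht
    have h1 : HasDerivAt (fun t : ℝ => -(lam * t)) (-lam) t := by
      simpa using (hasDerivAt_id t).const_mul (-lam)
    exact h1.exp.hasDerivWithinAt.mul (hdH t ht)
  · intro t _
    simpa using ((hasDerivAt_id t).const_mul G).hasDerivWithinAt
  · intro t ht
    have h1 := hle t (Ico_subset_Icc_self ht)
    have h2 : Real.exp (-(lam * t)) ≤ 1 := by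
      rw [Real.exp_le_one_iff]
      have := mul_nonneg hlam ht.1
      linarith
    calc _ = Real.exp (-(lam * t)) * (h t - lam * ∫ s in (0 : ℝ)..t, h s) := by ring
      _ ≤ Real.exp (-(lam * t)) * G := by
        refine mul_le_mul_of_nonneg_left ?_ (Real.exp_pos _).le
        linarith
      _ ≤ G := mul_le_of_le_one_left hG h2

/-- Expand the nonnegative integral of `(g - I / t)²`, where `I / t` is the mean of `g`. -/
theorem sq_intervalIntegral_le {g : ℝ → ℝ} {t : ℝ} (ht : 0 ≤ t) (hg : ContinuousOn g (Icc 0 t)) :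
    (∫ s in (0 : ℝ)..t, g s) ^ 2 ≤ t * ∫ s in (0 : ℝ)..t, g s ^ 2 := by
  rcases ht.eq_or_lt with rfl | ht
  · simp
  set I := ∫ s in (0 : ℝ)..t, g s
  have h1 : IntervalIntegrable (fun s => g s ^ 2) volume 0 t :=
    (hg.pow 2).intervalIntegrable_of_Icc ht.le
  have h2 : IntervalIntegrable (fun s => 2 * (I / t) * g s) volume 0 t :=
    (hg.intervalIntegrable_of_Icc ht.le).const_mul _
  have h3 : 0 ≤ ∫ s in (0 : ℝ)..t, (g s - I / t) ^ 2 :=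
    intervalIntegral.integral_nonneg ht.le fun s _ => sq_nonneg _
  have h4 : ∫ s in (0 : ℝ)..t, (g s - I / t) ^ 2
      = (∫ s in (0 : ℝ)..t, g s ^ 2) - 2 * (I / t) * I + t * (I / t) ^ 2 := by
    have : ∀ s, (g s - I / t) ^ 2 = g s ^ 2 - 2 * (I / t) * g s + (I / t) ^ 2 := fun s => by ring
    simp only [this]
    rw [intervalIntegral.integral_add (h1.sub h2) (by simp), intervalIntegral.integral_sub h1 h2,
      intervalIntegral.integral_const_mul]
    simp [I]
  rw [h4] at h3
  have h5 : (∫ s in (0 : ℝ)..t, g s ^ 2) - 2 * (I / t) * I + t * (I / t) ^ 2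
      = (∫ s in (0 : ℝ)..t, g s ^ 2) - I ^ 2 / t := by
    field_simp
    ring
  rw [h5] at h3
  have h6 : I ^ 2 / t ≤ ∫ s in (0 : ℝ)..t, g s ^ 2 := by linarith
  rwa [div_le_iff₀' ht] at h6

/-! ### The energy estimate -/

namespace WavePINN

variable {d : ℕ} {Ω : Set (EuclideanSpace ℝ (Fin d))} {T : ℝ}

section

variable (hΩ : IsLipschitzDomain Ω) (hb : Bornology.IsBounded Ω) (hT : 0 < T)
  {w : EuclideanSpace ℝ (Fin d) × ℝ → ℝ} (hw : ContDiffOn ℝ 2 w (cylinder (closure Ω) T))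

include hΩ hb hT hw

/-- The energy inequality for the wave operator. -/
theorem setIntegral_energyDensity_le {N : ℝ} (hN : 0 ≤ N)
    (hGN : ∀ x ∈ frontier Ω, ∀ s ∈ Icc 0 T, ‖cylGrad Ω T w (x, s)‖ ≤ N) {β : ℝ≥0∞} (hβ : β ≠ ∞)
    (hwβ : ∫⁻ s in Icc 0 T, ∫⁻ x, ‖cylDeriv Ω T w (x, s) (0, 1)‖ₑ ∂(surfaceMeasure Ω) ≤ β)
    {t : ℝ} (ht : t ∈ Icc 0 T) :
    ∫ x in Ω, (‖cylGrad Ω T w (x, t)‖ ^ 2 + cylDeriv Ω T w (x, t) (0, 1) ^ 2) ≤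
      (∫ x in Ω, (‖cylGrad Ω T w (x, 0)‖ ^ 2 + cylDeriv Ω T w (x, 0) (0, 1) ^ 2))
      + 2 * (N * β.toReal)
      + ∫ s in (0 : ℝ)..t, ∫ x in Ω, 2 * (cylDeriv Ω T w (x, s) (0, 1) *
        (cylDeriv2 Ω T w (x, s) (0, 1) (0, 1) - cylLaplacian Ω T w (x, s))) := by
  have hc1 := continuousOn_cylDeriv_time hΩ hT hw
  have hcG := continuousOn_cylGrad hΩ hT hw
  have hc2 := continuousOn_cylDeriv2 hΩ hT hw
  have hcL := continuousOn_cylLaplacian hΩ hT hw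
  have hcF := continuousOn_fluxDivergence hΩ hT hw
  have hc2tt : ContinuousOn (fun z => cylDeriv2 Ω T w z (0, 1) (0, 1)) (cylinder (closure Ω) T) :=
    (hc2.clm_apply continuousOn_const).clm_apply continuousOn_const
  have hq : ContinuousOn (fun z => 2 * (cylDeriv Ω T w z (0, 1) *
      (cylDeriv2 Ω T w z (0, 1) (0, 1) - cylLaplacian Ω T w z))) (cylinder (closure Ω) T) :=
    continuousOn_const.mul (hc1.mul (hc2tt.sub hcL))
  have he' : ContinuousOn (fun z => 2 * cylDeriv2 Ω T w z (0, 1) (cylGrad Ω T w z, 0)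
      + 2 * (cylDeriv Ω T w z (0, 1) * cylDeriv2 Ω T w z (0, 1) (0, 1)))
      (cylinder (closure Ω) T) :=
    (continuousOn_const.mul ((hc2.clm_apply continuousOn_const).clm_apply
      (hcG.prodMk continuousOn_const))).add (continuousOn_const.mul (hc1.mul hc2tt))
  have h1 := setIntegral_slice_eq_add hΩ.1 hb (g := fun z => ‖cylGrad Ω T w z‖ ^ 2
    + cylDeriv Ω T w z (0, 1) ^ 2) ((hcG.norm.pow 2).add (hc1.pow 2)) he'
    (fun x hx s hs => hasDerivWithinAt_energyDensity hΩ hT hw (z := (x, s))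
      ⟨subset_closure hx, hs⟩) ht
  rw [h1, add_assoc]
  gcongr
  have h2 : ∫ s in (0 : ℝ)..t, ∫ x in Ω, (2 * cylDeriv2 Ω T w (x, s) (0, 1) (cylGrad Ω T w (x, s), 0)
      + 2 * (cylDeriv Ω T w (x, s) (0, 1) * cylDeriv2 Ω T w (x, s) (0, 1) (0, 1)))
      = ∫ s in (0 : ℝ)..t, (2 * (∫ x in Ω, fluxDivergence Ω T w (x, s))
        + ∫ x in Ω, 2 * (cylDeriv Ω T w (x, s) (0, 1) *
          (cylDeriv2 Ω T w (x, s) (0, 1) (0, 1) - cylLaplacian Ω T w (x, s)))) := by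
    -- The endpoints are discarded because symmetry of the second derivative is available only at
    -- interior times.
    rw [intervalIntegral.integral_of_le ht.1, intervalIntegral.integral_of_le ht.1,
      integral_Ioc_eq_integral_Ioo, integral_Ioc_eq_integral_Ioo]
    refine setIntegral_congr_fun measurableSet_Ioo fun s hs => ?_
    have hs' : s ∈ Ioo 0 T := ⟨hs.1, hs.2.trans_le ht.2⟩
    have hsI := Ioo_subset_Icc_self hs'
    rw [← integral_const_mul, ← integral_add ((integrableOn_slice hb hcF hsI).const_mul 2)
      (integrableOn_slice hb hq hsI)]
    refine setIntegral_congr_fun hΩ.1.measurableSet fun x hx => ?_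
    simp only [fluxDivergence]
    rw [cylDeriv2_symm hΩ hT hw hx hs' (0, 1)]
    ring
  have hF := intervalIntegrable_setIntegral_slice hΩ.1 hb hcF ht
  rw [h2, intervalIntegral.integral_add (hF.const_mul 2)
    (intervalIntegrable_setIntegral_slice hΩ.1 hb hq ht), intervalIntegral.integral_const_mul]
  gcongr
  have h3 : ENNReal.ofReal N * β ≠ ∞ := ENNReal.mul_ne_top ENNReal.ofReal_ne_top hβ
  have h4 : (ENNReal.ofReal N * β).toReal = N * β.toReal := by
    rw [ENNReal.toReal_mul, ENNReal.toReal_ofReal hN]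
  rw [intervalIntegral.integral_of_le ht.1, ← h4]
  have hsub : Ioc 0 t ⊆ Icc 0 T := Ioc_subset_Icc_self.trans (Icc_subset_Icc_right ht.2)
  refine integral_le_toReal_lintegral_ofReal
    ((intervalIntegrable_iff_integrableOn_Ioc_of_le ht.1).1 hF) h3 ?_
  -- Only an upper bound for the flux is needed. Working with lower integrals avoids measurability
  -- in `s` of the surface integral.
  calc _ ≤ ∫⁻ s in Ioc 0 t, ENNReal.ofReal N *
        ∫⁻ x, ‖cylDeriv Ω T w (x, s) (0, 1)‖ₑ ∂(surfaceMeasure Ω) := by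
        refine setLIntegral_mono' measurableSet_Ioc fun s hs => ?_
        refine (ENNReal.ofReal_le_ofReal (le_abs_self _)).trans ?_
        rw [← Real.enorm_eq_ofReal_abs]
        refine (enorm_setIntegral_fluxDivergence_le hΩ hT hw hb (hsub hs)).trans ?_
        rw [← lintegral_const_mul' _ _ ENNReal.ofReal_ne_top]
        refine setLIntegral_mono' isClosed_frontier.measurableSet fun x hx => ?_
        rw [mul_comm]
        gcongr
        rw [← ofReal_norm]
        exact ENNReal.ofReal_le_ofReal (hGN x hx s (hsub hs))
    _ = ENNReal.ofReal N * ∫⁻ s in Ioc 0 t,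
        ∫⁻ x, ‖cylDeriv Ω T w (x, s) (0, 1)‖ₑ ∂(surfaceMeasure Ω) :=
        lintegral_const_mul' _ _ ENNReal.ofReal_ne_top
    _ ≤ ENNReal.ofReal N * β := by
        gcongr
        exact (lintegral_mono_set hsub).trans hwβ

omit hΩ hb hT in
theorem hasDerivWithinAt_time_slice {x : EuclideanSpace ℝ (Fin d)} (hx : x ∈ Ω) {t : ℝ}
    (ht : t ∈ Icc 0 T) :
    HasDerivWithinAt (fun s => w (x, s)) (cylDeriv Ω T w (x, t) (0, 1)) (Icc 0 T) t :=
  hasDerivWithinAt_time (subset_closure hx)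
    (hasFDerivWithinAt_cylDeriv hw (z := (x, t)) ⟨subset_closure hx, ht⟩)

/-- From `2 w w_t ≤ w² + w_t²`. The coefficient one makes this the right bound for `T ≥ 1`. -/
theorem setIntegral_sq_le_add_intervalIntegral {t : ℝ} (ht : t ∈ Icc 0 T) :
    ∫ x in Ω, w (x, t) ^ 2 ≤ (∫ x in Ω, w (x, 0) ^ 2)
      + ∫ s in (0 : ℝ)..t, ∫ x in Ω, (w (x, s) ^ 2 + cylDeriv Ω T w (x, s) (0, 1) ^ 2) := by
  have hc1 := continuousOn_cylDeriv_time hΩ hT hw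
  have hcw := hw.continuousOn
  have hp : ContinuousOn (fun z => 2 * (w z * cylDeriv Ω T w z (0, 1))) (cylinder (closure Ω) T) :=
    continuousOn_const.mul (hcw.mul hc1)
  have hs2 : ContinuousOn (fun z => w z ^ 2 + cylDeriv Ω T w z (0, 1) ^ 2)
      (cylinder (closure Ω) T) := (hcw.pow 2).add (hc1.pow 2)
  rw [setIntegral_slice_eq_add hΩ.1 hb (g := fun z => w z ^ 2) (hcw.pow 2) hp (fun x hx s hs => by
    refine ((hasDerivWithinAt_time_slice hw hx hs).pow 2).congr_deriv ?_
    simp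
    ring) ht]
  gcongr
  refine intervalIntegral.integral_mono_on ht.1
    (intervalIntegrable_setIntegral_slice hΩ.1 hb hp ht)
    (intervalIntegrable_setIntegral_slice hΩ.1 hb hs2 ht) fun s hs => ?_
  have hsI : s ∈ Icc 0 T := Icc_subset_Icc_right ht.2 hs
  refine integral_mono (integrableOn_slice hb hp hsI) (integrableOn_slice hb hs2 hsI) fun x => ?_
  have := sq_nonneg (w (x, s) - cylDeriv Ω T w (x, s) (0, 1))
  simp only
  linarith

/-- Cauchy–Schwarz in time for `w(t) - w(0)`. The coefficient `2T` makes this the right bound for `T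
≤ 1`. -/
theorem setIntegral_sq_le_two_mul_add_intervalIntegral {t : ℝ} (ht : t ∈ Icc 0 T) :
    ∫ x in Ω, w (x, t) ^ 2 ≤ 2 * (∫ x in Ω, w (x, 0) ^ 2)
      + 2 * T * ∫ s in (0 : ℝ)..t, ∫ x in Ω, cylDeriv Ω T w (x, s) (0, 1) ^ 2 := by
  have hc1 := continuousOn_cylDeriv_time hΩ hT hw
  have hcw := hw.continuousOn
  have h0 : (0 : ℝ) ∈ Icc 0 T := ⟨le_rfl, hT.le⟩
  have hi := integrable_prod_of_continuousOn hb (g := fun z => cylDeriv Ω T w z (0, 1) ^ 2)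
    (hc1.pow 2)
    ((Ioc_subset_Icc_self (a := 0) (b := t)).trans (Icc_subset_Icc_right ht.2))
  rw [intervalIntegral_setIntegral_eq hb (g := fun z => cylDeriv Ω T w z (0, 1) ^ 2) (hc1.pow 2) ht,
    integral_prod _ hi, ← integral_const_mul, ← integral_const_mul,
    ← integral_add ((integrableOn_slice hb (g := fun z => w z ^ 2) (hcw.pow 2) h0).const_mul 2)
      (hi.integral_prod_left.const_mul _)]
  refine setIntegral_mono_on (integrableOn_slice hb (g := fun z => w z ^ 2) (hcw.pow 2) ht)
    (((integrableOn_slice hb (g := fun z => w z ^ 2) (hcw.pow 2) h0).const_mul 2).add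
      (hi.integral_prod_left.const_mul _)) hΩ.1.measurableSet fun x hx => ?_
  have hsub : Icc 0 t ⊆ Icc 0 T := Icc_subset_Icc_right ht.2
  have hcx : ContinuousOn (fun s => w (x, s)) (Icc 0 t) :=
    hcw.comp (by fun_prop) fun s hs => ⟨subset_closure hx, hsub hs⟩
  have hcx' : ContinuousOn (fun s => cylDeriv Ω T w (x, s) (0, 1)) (Icc 0 t) :=
    hc1.comp (by fun_prop) fun s hs => ⟨subset_closure hx, hsub hs⟩
  have hftc := intervalIntegral.integral_eq_sub_of_hasDerivAt_of_le ht.1 hcx (fun s hs =>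
      (hasDerivWithinAt_time_slice hw hx (hsub (Ioo_subset_Icc_self hs))).hasDerivAt
        (Icc_mem_nhds hs.1 (hs.2.trans_le ht.2))) (hcx'.intervalIntegrable_of_Icc ht.1)
  have hcs := sq_intervalIntegral_le ht.1 hcx'
  rw [hftc] at hcs
  rw [← intervalIntegral.integral_of_le ht.1]
  have hnn : 0 ≤ ∫ s in (0 : ℝ)..t, cylDeriv Ω T w (x, s) (0, 1) ^ 2 :=
    intervalIntegral.integral_nonneg ht.1 fun _ _ => sq_nonneg _
  have h1 := mul_le_mul_of_nonneg_right ht.2 hnn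
  -- This square is exactly `2 w(0)² + 2 (w(t) - w(0))² - w(t)²`.
  have h2 := sq_nonneg (w (x, t) - 2 * w (x, 0))
  nlinarith

/-- The a priori estimate for the wave operator in terms of initial, boundary and interior data. -/
theorem intervalIntegral_sq_add_sq_le {N : ℝ} (hN : 0 ≤ N)
    (hGN : ∀ x ∈ frontier Ω, ∀ s ∈ Icc 0 T, ‖cylGrad Ω T w (x, s)‖ ≤ N) {β : ℝ≥0∞} (hβ : β ≠ ∞)
    (hwβ : ∫⁻ s in Icc 0 T, ∫⁻ x, ‖cylDeriv Ω T w (x, s) (0, 1)‖ₑ ∂(surfaceMeasure Ω) ≤ β)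
    {R : EuclideanSpace ℝ (Fin d) × ℝ → ℝ} (hR : ∫⁻ z in cylinder Ω T, ‖R z‖ₑ ^ 2 ≠ ∞)
    {C : ℝ} (hC : 0 ≤ C)
    (hle : ∀ᵐ x ∂(volume.restrict Ω), ∀ s ∈ Icc 0 T, 2 * (cylDeriv Ω T w (x, s) (0, 1) *
        (cylDeriv2 Ω T w (x, s) (0, 1) (0, 1) - cylLaplacian Ω T w (x, s))) ≤ R (x, s) ^ 2 +
          (cylDeriv Ω T w (x, s) (0, 1) ^ 2
            + C * (w (x, s) ^ 2 + cylDeriv Ω T w (x, s) (0, 1) ^ 2))) :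
    ∫ s in (0 : ℝ)..T, ∫ x in Ω, (w (x, s) ^ 2 + cylDeriv Ω T w (x, s) (0, 1) ^ 2) ≤
      ((∫ x in Ω, (‖cylGrad Ω T w (x, 0)‖ ^ 2 + cylDeriv Ω T w (x, 0) (0, 1) ^ 2))
        + 2 * (N * β.toReal) + (∫⁻ z in cylinder Ω T, ‖R z‖ₑ ^ 2).toReal
        + 2 * ∫ x in Ω, w (x, 0) ^ 2) * T * Real.exp ((1 + C + 4 * Real.sqrt T) * T) := by
  have hc1 := continuousOn_cylDeriv_time hΩ hT hw
  have hcG := continuousOn_cylGrad hΩ hT hw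
  have hc2 := continuousOn_cylDeriv2 hΩ hT hw
  have hcL := continuousOn_cylLaplacian hΩ hT hw
  have hcw := hw.continuousOn
  have hc2tt : ContinuousOn (fun z => cylDeriv2 Ω T w z (0, 1) (0, 1)) (cylinder (closure Ω) T) :=
    (hc2.clm_apply continuousOn_const).clm_apply continuousOn_const
  have hq : ContinuousOn (fun z => 2 * (cylDeriv Ω T w z (0, 1) *
      (cylDeriv2 Ω T w z (0, 1) (0, 1) - cylLaplacian Ω T w z))) (cylinder (closure Ω) T) :=
    continuousOn_const.mul (hc1.mul (hc2tt.sub hcL))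
  have ha2 : ContinuousOn (fun z => cylDeriv Ω T w z (0, 1) ^ 2) (cylinder (closure Ω) T) :=
    hc1.pow 2
  have hb2 : ContinuousOn (fun z => w z ^ 2) (cylinder (closure Ω) T) := hcw.pow 2
  have hs2 : ContinuousOn (fun z => w z ^ 2 + cylDeriv Ω T w z (0, 1) ^ 2)
      (cylinder (closure Ω) T) := hb2.add ha2
  have hm : ContinuousOn (fun z => cylDeriv Ω T w z (0, 1) ^ 2
      + C * (w z ^ 2 + cylDeriv Ω T w z (0, 1) ^ 2)) (cylinder (closure Ω) T) :=
    ha2.add (continuousOn_const.mul hs2)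
  set ρ := (∫⁻ z in cylinder Ω T, ‖R z‖ₑ ^ 2).toReal with hρ
  set e0 := ∫ x in Ω, (‖cylGrad Ω T w (x, 0)‖ ^ 2 + cylDeriv Ω T w (x, 0) (0, 1) ^ 2) with he0
  set b0 := ∫ x in Ω, w (x, 0) ^ 2 with hb0
  have hb0n : 0 ≤ b0 := integral_nonneg fun x => sq_nonneg _
  have he0n : 0 ≤ e0 := integral_nonneg fun x => by positivity
  have hρn : 0 ≤ ρ := ENNReal.toReal_nonneg
  have hβn : 0 ≤ N * β.toReal := mul_nonneg hN ENNReal.toReal_nonneg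
  refine intervalIntegral_le_of_le_add_mul_intervalIntegral hT.le (by positivity) (by positivity)
    (continuousOn_setIntegral_slice hΩ.1 hb hs2) fun t ht => ?_
  have hE := setIntegral_energyDensity_le hΩ hb hT hw hN hGN hβ hwβ ht
  have hQ := intervalIntegral_setIntegral_le_add_toReal hb hq hm hR hle ht
  set a : ℝ := ∫ s in (0 : ℝ)..t, ∫ x in Ω, cylDeriv Ω T w (x, s) (0, 1) ^ 2 with ha
  set H : ℝ := ∫ s in (0 : ℝ)..t, ∫ x in Ω, (w (x, s) ^ 2 + cylDeriv Ω T w (x, s) (0, 1) ^ 2)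
    with hH
  have hmsplit : ∫ s in (0 : ℝ)..t, ∫ x in Ω, (cylDeriv Ω T w (x, s) (0, 1) ^ 2
      + C * (w (x, s) ^ 2 + cylDeriv Ω T w (x, s) (0, 1) ^ 2)) = a + C * H := by
    rw [ha, hH, ← intervalIntegral.integral_const_mul, ← intervalIntegral.integral_add
      (intervalIntegrable_setIntegral_slice hΩ.1 hb ha2 ht)
      ((intervalIntegrable_setIntegral_slice hΩ.1 hb hs2 ht).const_mul C)]
    refine intervalIntegral.integral_congr fun s hs => ?_
    rw [uIcc_of_le ht.1] at hs
    have hsI : s ∈ Icc 0 T := Icc_subset_Icc_right ht.2 hs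
    rw [← integral_const_mul, ← integral_add (integrableOn_slice hb ha2 hsI)
      ((integrableOn_slice hb hs2 hsI).const_mul C)]
  have haH : a ≤ H := by
    refine intervalIntegral.integral_mono_on ht.1
      (intervalIntegrable_setIntegral_slice hΩ.1 hb ha2 ht)
      (intervalIntegrable_setIntegral_slice hΩ.1 hb hs2 ht) fun s hs => ?_
    have hsI : s ∈ Icc 0 T := Icc_subset_Icc_right ht.2 hs
    refine integral_mono (integrableOn_slice hb ha2 hsI) (integrableOn_slice hb hs2 hsI)
      fun x => ?_
    have := sq_nonneg (w (x, s))
    simp only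
    linarith
  have ha0 : 0 ≤ a := intervalIntegral.integral_nonneg ht.1 fun s _ =>
    integral_nonneg fun x => sq_nonneg _
  have hkin : ∫ x in Ω, cylDeriv Ω T w (x, t) (0, 1) ^ 2 ≤
      ∫ x in Ω, (‖cylGrad Ω T w (x, t)‖ ^ 2 + cylDeriv Ω T w (x, t) (0, 1) ^ 2) := by
    refine integral_mono (integrableOn_slice hb ha2 ht)
      (integrableOn_slice hb ((hcG.norm.pow 2).add ha2) ht) fun x => ?_
    have := sq_nonneg ‖cylGrad Ω T w (x, t)‖
    simp only
    linarith
  have hsplit : ∫ x in Ω, (w (x, t) ^ 2 + cylDeriv Ω T w (x, t) (0, 1) ^ 2)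
      = (∫ x in Ω, w (x, t) ^ 2) + ∫ x in Ω, cylDeriv Ω T w (x, t) (0, 1) ^ 2 :=
    integral_add (integrableOn_slice hb hb2 ht) (integrableOn_slice hb ha2 ht)
  have hsq : Real.sqrt T * Real.sqrt T = T := Real.mul_self_sqrt hT.le
  have hsq0 : 0 ≤ Real.sqrt T := Real.sqrt_nonneg T
  have hH0 : 0 ≤ H := ha0.trans haH
  rw [hmsplit] at hQ
  rw [hsplit]
  -- Both regimes fit under the rate `4 √T`: `2T ≤ 4√T` when `T ≤ 1`, and `1 ≤ 4√T` when `T ≥ 1`.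
  -- The initial term `2 b0` covers both.
  rcases le_total T 1 with hT1 | hT1
  · have h1 := setIntegral_sq_le_two_mul_add_intervalIntegral hΩ hb hT hw ht
    have h2 : Real.sqrt T ≤ 1 := Real.sqrt_le_one.2 hT1
    have h3 : 2 * T ≤ 4 * Real.sqrt T := by nlinarith
    have h4 : 2 * T * a ≤ 4 * Real.sqrt T * H := mul_le_mul h3 haH ha0 (by positivity)
    rw [← ha, ← hb0] at h1
    linarith
  · have h1 := setIntegral_sq_le_add_intervalIntegral hΩ hb hT hw ht
    have h2 : 1 ≤ Real.sqrt T := Real.one_le_sqrt.2 hT1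
    have h3 : 1 * H ≤ 4 * Real.sqrt T * H := mul_le_mul_of_nonneg_right (by linarith) hH0
    rw [← hH, ← hb0] at h1
    linarith

end

end WavePINN

/-! ### The error, its residuals and the final estimate -/

theorem eLpNorm_two_sq {α F : Type*} [MeasurableSpace α] [NormedAddCommGroup F] (f : α → F)
    (μ : Measure α) : eLpNorm f 2 μ ^ 2 = ∫⁻ x, ‖f x‖ₑ ^ 2 ∂μ := by
  have h := eLpNorm_nnreal_pow_eq_lintegral (f := f) (μ := μ) (p := 2) two_ne_zero
  simpa using h

namespace WavePINN

variable {d : ℕ} {Ω : Set (EuclideanSpace ℝ (Fin d))} {T : ℝ}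

section

variable (hΩ : IsLipschitzDomain Ω) (hT : 0 < T) {u v : EuclideanSpace ℝ (Fin d) × ℝ → ℝ}
  (hv : ContDiffOn ℝ 2 v (cylinder (closure Ω) T))
  (hu : ContDiffOn ℝ 2 u (cylinder (closure Ω) T))
  {z : EuclideanSpace ℝ (Fin d) × ℝ} (hz : z ∈ cylinder (closure Ω) T)

include hΩ hT hv hu hz

theorem cylDeriv_sub : cylDeriv Ω T (v - u) z = cylDeriv Ω T v z - cylDeriv Ω T u z :=
  fderivWithin_sub (hΩ.uniqueDiffOn_cylinder hT z hz)
    (hv.differentiableOn (by norm_num) z hz) (hu.differentiableOn (by norm_num) z hz)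

theorem cylDeriv2_sub : cylDeriv2 Ω T (v - u) z = cylDeriv2 Ω T v z - cylDeriv2 Ω T u z := by
  have h1 : cylDeriv2 Ω T (v - u) z
      = fderivWithin ℝ (cylDeriv Ω T v - cylDeriv Ω T u) (cylinder (closure Ω) T) z :=
    fderivWithin_congr (fun y hy => cylDeriv_sub hΩ hT hv hu hy) (cylDeriv_sub hΩ hT hv hu hz)
  rw [h1]
  exact fderivWithin_sub (hΩ.uniqueDiffOn_cylinder hT z hz)
    ((contDiffOn_cylDeriv hΩ hT hv).differentiableOn one_ne_zero z hz)
    ((contDiffOn_cylDeriv hΩ hT hu).differentiableOn one_ne_zero z hz)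

theorem cylGrad_sub : cylGrad Ω T (v - u) z = cylGrad Ω T v z - cylGrad Ω T u z := by
  simp only [cylGrad]
  rw [cylDeriv_sub hΩ hT hv hu hz, ContinuousLinearMap.sub_comp, map_sub]

theorem cylLaplacian_sub :
    cylLaplacian Ω T (v - u) z = cylLaplacian Ω T v z - cylLaplacian Ω T u z := by
  simp only [cylLaplacian]
  rw [cylDeriv2_sub hΩ hT hv hu hz, ← Finset.sum_sub_distrib]
  rfl

end

section

variable (hΩ : IsLipschitzDomain Ω) (hb : Bornology.IsBounded Ω) (hT : 0 < T)
  {w : EuclideanSpace ℝ (Fin d) × ℝ → ℝ}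

include hb in
theorem abs_le_normC0 (hw : ContinuousOn w (cylinder (closure Ω) T))
    {z : EuclideanSpace ℝ (Fin d) × ℝ} (hz : z ∈ cylinder Ω T) : |w z| ≤ normC0 Ω T w := by
  -- An unbounded real supremum is `0` by convention, so boundedness on the compact closed cylinder
  -- has to come first.
  obtain ⟨C, hC⟩ := (isCompact_cylinder_closure (T := T) hb).exists_bound_of_continuousOn hw
  refine le_ciSup (f := fun z : cylinder Ω T => |w z|) ⟨C, ?_⟩ ⟨z, hz⟩
  rintro _ ⟨y, rfl⟩
  exact hC _ ⟨subset_closure y.2.1, y.2.2⟩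

theorem normC0_nonneg (Ω : Set (EuclideanSpace ℝ (Fin d))) (T : ℝ)
    (w : EuclideanSpace ℝ (Fin d) × ℝ → ℝ) : 0 ≤ normC0 Ω T w :=
  Real.iSup_nonneg fun _ => abs_nonneg _

theorem normC1_nonneg (Ω : Set (EuclideanSpace ℝ (Fin d))) (T : ℝ)
    (w : EuclideanSpace ℝ (Fin d) × ℝ → ℝ) : 0 ≤ normC1 Ω T w :=
  (normC0_nonneg Ω T w).trans (le_max_left _ _)

-- The norm is a supremum over `Ω × [0,T]`, while the flux needs the gradient on `∂Ω`; continuity of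
-- `cylGrad` carries the bound to the closure.
include hΩ hb hT in
theorem norm_cylGrad_le_normC1 (hw : ContDiffOn ℝ 2 w (cylinder (closure Ω) T))
    {x : EuclideanSpace ℝ (Fin d)} (hx : x ∈ closure Ω) {t : ℝ} (ht : t ∈ Icc 0 T) :
    ‖cylGrad Ω T w (x, t)‖ ≤ normC1 Ω T w := by
  have hcG := continuousOn_cylGrad hΩ hT hw
  have hc1 := continuousOn_cylDeriv_time hΩ hT hw
  have hcs : ContinuousOn (fun z => Real.sqrt (‖cylGrad Ω T w z‖ ^ 2
      + cylDeriv Ω T w z (0, 1) ^ 2)) (cylinder (closure Ω) T) :=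
    ((hcG.norm.pow 2).add (hc1.pow 2)).sqrt
  obtain ⟨C, hC⟩ := (isCompact_cylinder_closure (T := T) hb).exists_bound_of_continuousOn hcs
  have hsame : ∀ y ∈ cylinder Ω T, Real.sqrt (‖spaceGrad w y‖ ^ 2 + (timeDeriv T w y) ^ 2)
      = Real.sqrt (‖cylGrad Ω T w y‖ ^ 2 + cylDeriv Ω T w y (0, 1) ^ 2) := by
    intro y hy
    rw [spaceGrad_eq_cylGrad hΩ hw hy.1 hy.2,
      timeDeriv_eq_cylDeriv hT hw (z := y) ⟨subset_closure hy.1, hy.2⟩]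
  have hint : ∀ y ∈ Ω, ‖cylGrad Ω T w (y, t)‖ ≤ normC1 Ω T w := by
    intro y hy
    have h1 : ‖cylGrad Ω T w (y, t)‖ ≤ Real.sqrt (‖cylGrad Ω T w (y, t)‖ ^ 2
        + cylDeriv Ω T w (y, t) (0, 1) ^ 2) :=
      Real.le_sqrt_of_sq_le (le_add_of_nonneg_right (sq_nonneg _))
    refine h1.trans (le_trans ?_ (le_max_right _ _))
    rw [← hsame (y, t) ⟨hy, ht⟩]
    refine le_ciSup (f := fun z : cylinder Ω T =>
      Real.sqrt (‖spaceGrad w z‖ ^ 2 + (timeDeriv T w z) ^ 2)) ⟨C, ?_⟩ ⟨(y, t), hy, ht⟩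
    rintro _ ⟨y', rfl⟩
    simp only
    rw [hsame _ y'.2]
    exact (le_abs_self _).trans (hC _ ⟨subset_closure y'.2.1, y'.2.2⟩)
  exact le_on_closure hint
    ((hcG.comp (by fun_prop) fun y hy => ⟨hy, ht⟩ :
      ContinuousOn (fun y => cylGrad Ω T w (y, t)) (closure Ω)).norm) continuousOn_const hx

include hb in
theorem lintegral_cylinder_sq_eq {g : EuclideanSpace ℝ (Fin d) × ℝ → ℝ}
    (hg : ContinuousOn g (cylinder (closure Ω) T)) (hT : 0 ≤ T) :
    ∫⁻ z in cylinder Ω T, ‖g z‖ₑ ^ 2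
      = ENNReal.ofReal (∫ s in (0 : ℝ)..T, ∫ x in Ω, g (x, s) ^ 2) := by
  have hT' : T ∈ Icc 0 T := ⟨hT, le_rfl⟩
  have hi := integrable_prod_of_continuousOn hb (g := fun z => g z ^ 2) (hg.pow 2)
    (Ioc_subset_Icc_self (a := 0) (b := T))
  rw [intervalIntegral_setIntegral_eq hb (g := fun z => g z ^ 2) (hg.pow 2) hT',
    ofReal_integral_eq_lintegral_ofReal hi (Filter.Eventually.of_forall fun z => sq_nonneg _),
    cylinder, volume_restrict_cylinder, restrict_Ioc_eq_restrict_Icc]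
  refine lintegral_congr fun z => ?_
  rw [← enorm_pow, Real.enorm_of_nonneg (sq_nonneg _)]

theorem lintegral_sq_norm_eq {F : Type*} [NormedAddCommGroup F]
    (hb : Bornology.IsBounded Ω) {g : EuclideanSpace ℝ (Fin d) → F}
    (hg : ContinuousOn g (closure Ω)) :
    ∫⁻ x in Ω, ‖g x‖ₑ ^ 2 = ENNReal.ofReal (∫ x in Ω, ‖g x‖ ^ 2) := by
  have hi : IntegrableOn (fun x => ‖g x‖ ^ 2) Ω :=
    ((hg.norm.pow 2).integrableOn_compact hb.isCompact_closure).mono_set subset_closure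
  rw [ofReal_integral_eq_lintegral_ofReal hi (Filter.Eventually.of_forall fun z => sq_nonneg _)]
  refine lintegral_congr fun x => ?_
  rw [← ofReal_norm, ENNReal.ofReal_pow (norm_nonneg _)]

include hΩ hb hT in
/-- The boundary term is controlled by the Cauchy-Schwarz inequality. -/
theorem lintegral_boundary_le (hw : ContDiffOn ℝ 2 w (cylinder (closure Ω) T)) :
    ∫⁻ s in Icc 0 T, ∫⁻ x, ‖cylDeriv Ω T w (x, s) (0, 1)‖ₑ ∂(surfaceMeasure Ω) ≤
      (ENNReal.ofReal T * surfaceMeasure Ω univ) ^ (1 / 2 : ℝ)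
        * eLpNorm (fun z => cylDeriv Ω T w z (0, 1)) 2
          ((surfaceMeasure Ω).prod (volume.restrict (Icc 0 T))) ∧
    ∫⁻ s in Icc 0 T, ∫⁻ x, ‖cylDeriv Ω T w (x, s) (0, 1)‖ₑ ∂(surfaceMeasure Ω) ≠ ∞ := by
  have hfin : IsFiniteMeasure (surfaceMeasure Ω) := ⟨by
    simpa [surfaceMeasure] using hΩ.euclideanHausdorffMeasure_frontier_lt_top hb⟩
  have hc1 := continuousOn_cylDeriv_time hΩ hT hw
  have hfrm : MeasurableSet (frontier Ω) := isClosed_frontier.measurableSet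
  have hres : (surfaceMeasure Ω).prod (volume.restrict (Icc 0 T))
      = ((surfaceMeasure Ω).prod volume).restrict (frontier Ω ×ˢ Icc 0 T) := by
    rw [← Measure.prod_restrict]
    simp [surfaceMeasure, Measure.restrict_restrict hfrm]
  have hmeas : AEStronglyMeasurable (fun z => cylDeriv Ω T w z (0, 1))
      ((surfaceMeasure Ω).prod (volume.restrict (Icc 0 T))) := by
    rw [hres]
    exact (hc1.mono (prod_mono_left frontier_subset_closure)).aestronglyMeasurable
      (hfrm.prod measurableSet_Icc)
  have h1 : ∫⁻ s in Icc 0 T, ∫⁻ x, ‖cylDeriv Ω T w (x, s) (0, 1)‖ₑ ∂(surfaceMeasure Ω)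
      = ∫⁻ z, ‖cylDeriv Ω T w z (0, 1)‖ₑ
          ∂((surfaceMeasure Ω).prod (volume.restrict (Icc 0 T))) :=
    (lintegral_prod_symm _ hmeas.enorm).symm
  rw [h1]
  constructor
  · have h2 := eLpNorm_le_eLpNorm_mul_rpow_measure_univ (p := 1) (q := 2) (by norm_num) hmeas
    rw [eLpNorm_one_eq_lintegral_enorm, ← univ_prod_univ, Measure.prod_prod] at h2
    refine h2.trans (le_of_eq ?_)
    rw [mul_comm]
    congr 1
    simp only [Measure.restrict_apply_univ, Real.volume_Icc, sub_zero]
    rw [mul_comm]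
    norm_num
  · obtain ⟨C, hC⟩ := (isCompact_cylinder_closure (T := T) hb).exists_bound_of_continuousOn hc1
    refine ne_of_lt (lt_of_le_of_lt (b := ∫⁻ _, ENNReal.ofReal C
      ∂((surfaceMeasure Ω).prod (volume.restrict (Icc 0 T)))) ?_ ?_)
    · rw [hres]
      refine setLIntegral_mono' (hfrm.prod measurableSet_Icc) fun z hz => ?_
      rw [← ofReal_norm]
      exact ENNReal.ofReal_le_ofReal (hC z ⟨frontier_subset_closure hz.1, hz.2⟩)
    · rw [lintegral_const]
      exact ENNReal.mul_lt_top ENNReal.ofReal_lt_top (measure_lt_top _ _)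

end

section

variable {a : EuclideanSpace ℝ (Fin d) → ℝ} {f : EuclideanSpace ℝ (Fin d) × ℝ → ℝ}
  {u₀ u₁ : EuclideanSpace ℝ (Fin d) → ℝ} {u v : EuclideanSpace ℝ (Fin d) × ℝ → ℝ}

theorem residualPDE_eq (hΩ : IsLipschitzDomain Ω) (hT : 0 < T)
    (hv : ContDiffOn ℝ 2 v (cylinder (closure Ω) T)) (hu : IsClassicalSolution Ω T a f u₀ u₁ u)
    {x : EuclideanSpace ℝ (Fin d)} (hx : x ∈ Ω) {t : ℝ} (ht : t ∈ Icc 0 T) :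
    residualPDE T a f v (x, t) = cylDeriv2 Ω T (v - u) (x, t) (0, 1) (0, 1)
      - cylLaplacian Ω T (v - u) (x, t) + a x * cylDeriv Ω T (v - u) (x, t) (0, 1)
      + (f (x, v (x, t)) - f (x, u (x, t))) := by
  have hz : (x, t) ∈ cylinder (closure Ω) T := ⟨subset_closure hx, ht⟩
  have hu2 := hu.contDiffOn
  have heq := hu.equation x hx t ht
  rw [timeDeriv_timeDeriv_eq_cylDeriv2 hΩ hT hu2 hz, spaceLaplacian_eq_cylDeriv2 hΩ hT hu2 hx ht,
    timeDeriv_eq_cylDeriv hT hu2 hz] at heq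
  simp only [residualPDE]
  rw [timeDeriv_timeDeriv_eq_cylDeriv2 hΩ hT hv hz, spaceLaplacian_eq_cylDeriv2 hΩ hT hv hx ht,
    timeDeriv_eq_cylDeriv hT hv hz, cylDeriv2_sub hΩ hT hv hu2 hz, cylDeriv_sub hΩ hT hv hu2 hz,
    cylLaplacian_sub hΩ hT hv hu2 hz]
  simp only [cylLaplacian, _root_.sub_apply]
  linarith

theorem residualU0_eq (hu : IsClassicalSolution Ω T a f u₀ u₁ u)
    {x : EuclideanSpace ℝ (Fin d)} (hx : x ∈ Ω) : residualU0 u₀ v x = (v - u) (x, 0) := by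
  simp [residualU0, hu.initial x hx]

theorem residualU1_eq (hΩ : IsLipschitzDomain Ω) (hT : 0 < T)
    (hv : ContDiffOn ℝ 2 v (cylinder (closure Ω) T)) (hu : IsClassicalSolution Ω T a f u₀ u₁ u)
    {x : EuclideanSpace ℝ (Fin d)} (hx : x ∈ Ω) :
    residualU1 T u₁ v x = cylDeriv Ω T (v - u) (x, 0) (0, 1) := by
  have hz : (x, (0 : ℝ)) ∈ cylinder (closure Ω) T := ⟨subset_closure hx, le_rfl, hT.le⟩
  rw [residualU1, ← hu.initial_deriv x hx, timeDeriv_eq_cylDeriv hT hv hz,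
    timeDeriv_eq_cylDeriv hT hu.contDiffOn hz, cylDeriv_sub hΩ hT hv hu.contDiffOn hz,
    _root_.sub_apply]

theorem residualGrad_eq (hΩ : IsLipschitzDomain Ω) (hT : 0 < T)
    (hv : ContDiffOn ℝ 2 v (cylinder (closure Ω) T)) (hu : IsClassicalSolution Ω T a f u₀ u₁ u)
    {x : EuclideanSpace ℝ (Fin d)} (hx : x ∈ Ω) :
    residualGrad u₀ v x = cylGrad Ω T (v - u) (x, 0) := by
  have h0 : (0 : ℝ) ∈ Icc 0 T := ⟨le_rfl, hT.le⟩
  have h1 : gradient u₀ x = spaceGrad u (x, 0) := by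
    simp only [spaceGrad, gradient]
    congr 1
    refine Filter.EventuallyEq.fderiv_eq ?_
    filter_upwards [hΩ.1.mem_nhds hx] with y hy using (hu.initial y hy).symm
  rw [residualGrad, h1, spaceGrad_eq_cylGrad hΩ hv hx h0,
    spaceGrad_eq_cylGrad hΩ hu.contDiffOn hx h0,
    cylGrad_sub hΩ hT hv hu.contDiffOn (z := (x, 0)) ⟨subset_closure hx, h0⟩]

/-- The boundary condition on `u` holds at all times, so it can be differentiated in `t`. -/
theorem residualBdryUt_eq (hΩ : IsLipschitzDomain Ω) (hT : 0 < T)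
    (hv : ContDiffOn ℝ 2 v (cylinder (closure Ω) T)) (hu : IsClassicalSolution Ω T a f u₀ u₁ u)
    {x : EuclideanSpace ℝ (Fin d)} (hx : x ∈ frontier Ω) {t : ℝ} (ht : t ∈ Icc 0 T) :
    residualBdryUt T v (x, t) = cylDeriv Ω T (v - u) (x, t) (0, 1) := by
  have hz : (x, t) ∈ cylinder (closure Ω) T := ⟨frontier_subset_closure hx, ht⟩
  have h1 : timeDeriv T u (x, t) = 0 := by
    simp only [timeDeriv]
    rw [derivWithin_congr (f := fun _ => (0 : ℝ)) (fun s hs => hu.boundary x hx s hs)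
      (hu.boundary x hx t ht)]
    simp
  rw [residualBdryUt, cylDeriv_sub hΩ hT hv hu.contDiffOn hz, _root_.sub_apply,
    ← timeDeriv_eq_cylDeriv hT hv hz, ← timeDeriv_eq_cylDeriv hT hu.contDiffOn hz, h1, sub_zero]

theorem nonlinearityConst_nonneg {c r : ℝ} (hc : 0 ≤ c) (hr : 1 ≤ r)
    (u w : EuclideanSpace ℝ (Fin d) × ℝ → ℝ) : 0 ≤ nonlinearityConst Ω T c r u w := by
  have h1 := normC0_nonneg Ω T u
  have h2 := normC0_nonneg Ω T w
  unfold nonlinearityConst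
  positivity

theorem abs_nonlinearity_sub_le (hΩ : IsLipschitzDomain Ω) (hb : Bornology.IsBounded Ω)
    {k : ℕ} {c r : ℝ} (hf : AssumptionA2 Ω f k c r)
    (hv : ContinuousOn v (cylinder (closure Ω) T)) (hu : ContinuousOn u (cylinder (closure Ω) T))
    {x : EuclideanSpace ℝ (Fin d)} (hx : x ∈ Ω) {t : ℝ} (ht : t ∈ Icc 0 T) :
    |f (x, v (x, t)) - f (x, u (x, t))| ≤ nonlinearityConst Ω T c r u (v - u) * |(v - u) (x, t)| := by
  have h1 := hf.abs_sub_le hΩ (subset_closure hx) (u (x, t)) ((v - u) (x, t))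
  have hc := hf.2.1
  have hr := hf.2.2.1
  rw [show u (x, t) + (v - u) (x, t) = v (x, t) by simp] at h1
  refine h1.trans (mul_le_mul_of_nonneg_right ?_ (abs_nonneg _))
  have h2 := abs_le_normC0 hb hu (z := (x, t)) ⟨hx, ht⟩
  have h3 := abs_le_normC0 hb (hv.sub hu) (z := (x, t)) ⟨hx, ht⟩
  unfold nonlinearityConst
  have h4 : 0 ≤ r := by linarith
  gcongr

/-- Insert `w_tt - Δw = R - a w_t - D`, with `D` the increment of `f`. Then `2 w_t R ≤ R² + w_t²`,
the damping term is nonpositive, and `2 |w_t| |D| ≤ 2 Ĉ |w_t| |w| ≤ Ĉ (w² + w_t²)`. -/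
theorem two_mul_cylDeriv_mul_le (hΩ : IsLipschitzDomain Ω) (hb : Bornology.IsBounded Ω)
    (hT : 0 < T) {k : ℕ} {c r : ℝ} (hf : AssumptionA2 Ω f k c r)
    (hv : ContDiffOn ℝ 2 v (cylinder (closure Ω) T)) (hu : IsClassicalSolution Ω T a f u₀ u₁ u)
    {x : EuclideanSpace ℝ (Fin d)} (hx : x ∈ Ω) (hax : 0 ≤ a x) {t : ℝ} (ht : t ∈ Icc 0 T) :
    2 * (cylDeriv Ω T (v - u) (x, t) (0, 1) * (cylDeriv2 Ω T (v - u) (x, t) (0, 1) (0, 1)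
      - cylLaplacian Ω T (v - u) (x, t))) ≤ residualPDE T a f v (x, t) ^ 2
      + (cylDeriv Ω T (v - u) (x, t) (0, 1) ^ 2 + nonlinearityConst Ω T c r u (v - u)
        * ((v - u) (x, t) ^ 2 + cylDeriv Ω T (v - u) (x, t) (0, 1) ^ 2)) := by
  have h1 := residualPDE_eq hΩ hT hv hu hx ht
  have h2 := abs_nonlinearity_sub_le hΩ hb hf hv.continuousOn hu.contDiffOn.continuousOn hx ht
  have hC := nonlinearityConst_nonneg (Ω := Ω) (T := T) hf.2.1.le hf.2.2.1 u (v - u)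
  set C := nonlinearityConst Ω T c r u (v - u)
  set p := cylDeriv Ω T (v - u) (x, t) (0, 1)
  set q := cylDeriv2 Ω T (v - u) (x, t) (0, 1) (0, 1) - cylLaplacian Ω T (v - u) (x, t)
  set R := residualPDE T a f v (x, t)
  set D := f (x, v (x, t)) - f (x, u (x, t))
  set y := (v - u) (x, t)
  have hq : q = R - a x * p - D := by linarith
  have h3 : -(2 * (p * D)) ≤ C * (y ^ 2 + p ^ 2) := by
    have h4 : -(2 * (p * D)) ≤ 2 * (|p| * |D|) := by
      have := neg_abs_le (p * D)
      rw [abs_mul] at this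
      linarith
    have h5 : |p| * |D| ≤ |p| * (C * |y|) := mul_le_mul_of_nonneg_left h2 (abs_nonneg _)
    have h6 : C * (2 * (|p| * |y|)) ≤ C * (y ^ 2 + p ^ 2) := by
      refine mul_le_mul_of_nonneg_left ?_ hC
      have := sq_nonneg (|p| - |y|)
      rw [← sq_abs p, ← sq_abs y]
      linarith
    linarith
  have h7 : 0 ≤ a x * p ^ 2 := mul_nonneg hax (sq_nonneg _)
  have h8 := sq_nonneg (R - p)
  rw [hq]
  linarith

/-- The error estimate for an arbitrary approximation of class `C²`. -/
theorem lintegral_error_le (hΩ : IsLipschitzDomain Ω) (hb : Bornology.IsBounded Ω)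
    (hT : 0 < T) {Cpw : ℝ} (hCpw : 0 < Cpw) (ha : AssumptionA1 Ω a) {k : ℕ} {c r : ℝ}
    (hf : AssumptionA2 Ω f k c r)
    (hv : ContDiffOn ℝ 2 v (cylinder (closure Ω) T)) (hu : IsClassicalSolution Ω T a f u₀ u₁ u) :
    (∫⁻ z in cylinder Ω T, ‖v z - u z‖ₑ ^ 2)
        + (∫⁻ z in cylinder Ω T, ‖timeDeriv T v z - timeDeriv T u z‖ₑ ^ 2) ≤
      ENNReal.ofReal (max 1 (2 * Cpw ^ 2)) *
        (eLpNorm (residualU1 T u₁ v) 2 (volume.restrict Ω) ^ 2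
          + eLpNorm (residualPDE T a f v) 2 (volume.restrict (cylinder Ω T)) ^ 2
          + eLpNorm (residualGrad u₀ v) 2 (volume.restrict Ω) ^ 2
          + 2 * (ENNReal.ofReal T * surfaceMeasure Ω univ) ^ (1 / 2 : ℝ)
              * ENNReal.ofReal (normC1 Ω T (v - u))
              * eLpNorm (residualBdryUt T v) 2
                  ((surfaceMeasure Ω).prod (volume.restrict (Icc 0 T)))
          + ENNReal.ofReal (2 / Cpw ^ 2)
              * eLpNorm (residualU0 u₀ v) 2 (volume.restrict Ω) ^ 2) *
        ENNReal.ofReal T *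
        ENNReal.ofReal (Real.exp (T * (max 1 (2 * Cpw ^ 2) *
          (1 + nonlinearityConst Ω T c r u (v - u) + 2 * Real.sqrt T / Cpw ^ 2)))) := by
  have hu2 := hu.contDiffOn
  have hw : ContDiffOn ℝ 2 (v - u) (cylinder (closure Ω) T) := hv.sub hu2
  set w := v - u with hwdef
  have hC := nonlinearityConst_nonneg (Ω := Ω) (T := T) hf.2.1.le hf.2.2.1 u w
  set C := nonlinearityConst Ω T c r u w
  set M := max 1 (2 * Cpw ^ 2)
  have hM1 : 1 ≤ M := le_max_left _ _
  have hM2 : 4 ≤ M * (2 / Cpw ^ 2) := by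
    have h1 : 2 * Cpw ^ 2 * (2 / Cpw ^ 2) = 4 := by field_simp; norm_num
    rw [← h1]
    exact mul_le_mul_of_nonneg_right (le_max_right _ _) (by positivity)
  have hM0 : ENNReal.ofReal M ≠ 0 := by
    rw [Ne, ENNReal.ofReal_eq_zero]
    linarith
  have hT0 : ENNReal.ofReal T ≠ 0 := by
    rw [Ne, ENNReal.ofReal_eq_zero]
    linarith
  have hexp0 : ∀ y, ENNReal.ofReal (Real.exp y) ≠ 0 := fun y => by
    rw [Ne, ENNReal.ofReal_eq_zero, not_le]
    exact Real.exp_pos y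
  simp only [eLpNorm_two_sq]
  -- An infinite residual makes the right-hand side infinite, since all factors multiplying it are
  -- nonzero. Otherwise passing to `toReal` loses nothing.
  by_cases hR : ∫⁻ z in cylinder Ω T, ‖residualPDE T a f v z‖ₑ ^ 2 = ∞
  · rw [hR]
    simp [hM0, hT0, hexp0, ENNReal.mul_top, ENNReal.top_mul]
  have hcw := hw.continuousOn
  have hc1 := continuousOn_cylDeriv_time hΩ hT hw
  have hcG := continuousOn_cylGrad hΩ hT hw
  have h0 : (0 : ℝ) ∈ Icc 0 T := ⟨le_rfl, hT.le⟩
  have hΩm := hΩ.1.measurableSet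
  have hQm : MeasurableSet (cylinder Ω T) := hΩm.prod measurableSet_Icc
  have hsl : ContinuousOn (fun x : EuclideanSpace ℝ (Fin d) => (x, (0 : ℝ))) (closure Ω) := by
    fun_prop
  have hmaps : MapsTo (fun x : EuclideanSpace ℝ (Fin d) => (x, (0 : ℝ))) (closure Ω)
      (cylinder (closure Ω) T) := fun x hx => ⟨hx, h0⟩
  obtain ⟨hβle, hβ⟩ := lintegral_boundary_le hΩ hb hT hw
  set β := ∫⁻ s in Icc 0 T, ∫⁻ x, ‖cylDeriv Ω T w (x, s) (0, 1)‖ₑ ∂(surfaceMeasure Ω) with hβdef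
  have hest := intervalIntegral_sq_add_sq_le hΩ hb hT hw (normC1_nonneg Ω T w)
    (fun x hx s hs => norm_cylGrad_le_normC1 hΩ hb hT hw (frontier_subset_closure hx) hs) hβ le_rfl
    hR hC (by
      filter_upwards [ae_restrict_mem hΩm,
        ae_mono (Measure.restrict_mono subset_closure le_rfl) ha.1] with x hx hax s hs
      exact two_mul_cylDeriv_mul_le hΩ hb hT hf hv hu hx hax.1 hs)
  -- the left-hand side
  have hlhs : (∫⁻ z in cylinder Ω T, ‖v z - u z‖ₑ ^ 2)
      + (∫⁻ z in cylinder Ω T, ‖timeDeriv T v z - timeDeriv T u z‖ₑ ^ 2)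
      = ENNReal.ofReal (∫ s in (0 : ℝ)..T, ∫ x in Ω,
          (w (x, s) ^ 2 + cylDeriv Ω T w (x, s) (0, 1) ^ 2)) := by
    have h1 : ∫⁻ z in cylinder Ω T, ‖timeDeriv T v z - timeDeriv T u z‖ₑ ^ 2
        = ∫⁻ z in cylinder Ω T, ‖cylDeriv Ω T w z (0, 1)‖ₑ ^ 2 := by
      refine setLIntegral_congr_fun hQm fun z hz => ?_
      have hz' : z ∈ cylinder (closure Ω) T := ⟨subset_closure hz.1, hz.2⟩
      rw [timeDeriv_eq_cylDeriv hT hv hz', timeDeriv_eq_cylDeriv hT hu2 hz', hwdef,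
        cylDeriv_sub hΩ hT hv hu2 hz', _root_.sub_apply]
    have h2 : ∫⁻ z in cylinder Ω T, ‖v z - u z‖ₑ ^ 2 = ∫⁻ z in cylinder Ω T, ‖w z‖ₑ ^ 2 := rfl
    have hT' : T ∈ Icc 0 T := ⟨hT.le, le_rfl⟩
    have hb2 : ContinuousOn (fun z => w z ^ 2) (cylinder (closure Ω) T) := hcw.pow 2
    have ha2 : ContinuousOn (fun z => cylDeriv Ω T w z (0, 1) ^ 2) (cylinder (closure Ω) T) :=
      hc1.pow 2
    rw [h1, h2, lintegral_cylinder_sq_eq hb hcw hT.le, lintegral_cylinder_sq_eq hb hc1 hT.le,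
      ← ENNReal.ofReal_add
        (intervalIntegral.integral_nonneg hT.le fun s _ => integral_nonneg fun x => sq_nonneg _)
        (intervalIntegral.integral_nonneg hT.le fun s _ => integral_nonneg fun x => sq_nonneg _),
      ← intervalIntegral.integral_add (intervalIntegrable_setIntegral_slice hΩ.1 hb hb2 hT')
        (intervalIntegrable_setIntegral_slice hΩ.1 hb ha2 hT')]
    congr 1
    refine intervalIntegral.integral_congr fun s hs => ?_
    rw [uIcc_of_le hT.le] at hs
    exact (integral_add (integrableOn_slice hb hb2 hs) (integrableOn_slice hb ha2 hs)).symm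
  -- the residuals
  have hU1 : ∫⁻ x in Ω, ‖residualU1 T u₁ v x‖ₑ ^ 2
      = ENNReal.ofReal (∫ x in Ω, cylDeriv Ω T w (x, 0) (0, 1) ^ 2) := by
    have h1 := lintegral_sq_norm_eq hb (hc1.comp hsl hmaps)
    simp only [Function.comp, Real.norm_eq_abs, sq_abs] at h1
    rw [← h1]
    refine setLIntegral_congr_fun hΩm fun x hx => ?_
    rw [residualU1_eq hΩ hT hv hu hx]
  have hU0 : ∫⁻ x in Ω, ‖residualU0 u₀ v x‖ₑ ^ 2 = ENNReal.ofReal (∫ x in Ω, w (x, 0) ^ 2) := by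
    have h1 := lintegral_sq_norm_eq hb (hcw.comp hsl hmaps)
    simp only [Function.comp, Real.norm_eq_abs, sq_abs] at h1
    rw [← h1]
    refine setLIntegral_congr_fun hΩm fun x hx => ?_
    rw [residualU0_eq hu hx]
  have hGr : ∫⁻ x in Ω, ‖residualGrad u₀ v x‖ₑ ^ 2
      = ENNReal.ofReal (∫ x in Ω, ‖cylGrad Ω T w (x, 0)‖ ^ 2) := by
    have h1 := lintegral_sq_norm_eq hb (hcG.comp hsl hmaps)
    simp only [Function.comp] at h1
    rw [← h1]
    refine setLIntegral_congr_fun hΩm fun x hx => ?_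
    rw [residualGrad_eq hΩ hT hv hu hx]
  have hBd : eLpNorm (residualBdryUt T v) 2 ((surfaceMeasure Ω).prod (volume.restrict (Icc 0 T)))
      = eLpNorm (fun z => cylDeriv Ω T w z (0, 1)) 2
          ((surfaceMeasure Ω).prod (volume.restrict (Icc 0 T))) := by
    refine eLpNorm_congr_ae ?_
    have hfin : IsFiniteMeasure (surfaceMeasure Ω) := ⟨by
      simpa [surfaceMeasure] using hΩ.euclideanHausdorffMeasure_frontier_lt_top hb⟩
    have h1 := (Measure.quasiMeasurePreserving_fst (μ := surfaceMeasure Ω)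
      (ν := volume.restrict (Icc 0 T))).ae (ae_restrict_mem isClosed_frontier.measurableSet)
    have h2 := (Measure.quasiMeasurePreserving_snd (μ := surfaceMeasure Ω)
      (ν := volume.restrict (Icc 0 T))).ae (ae_restrict_mem measurableSet_Icc)
    filter_upwards [h1, h2] with z hz1 hz2
    exact residualBdryUt_eq hΩ hT hv hu hz1 hz2
  rw [hlhs, hU1, hU0, hGr, hBd]
  set ρ := ∫⁻ z in cylinder Ω T, ‖residualPDE T a f v z‖ₑ ^ 2
  set a1 := ∫ x in Ω, cylDeriv Ω T w (x, 0) (0, 1) ^ 2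
  set g1 := ∫ x in Ω, ‖cylGrad Ω T w (x, 0)‖ ^ 2
  set b0 := ∫ x in Ω, w (x, 0) ^ 2
  set N := normC1 Ω T w
  have hN : 0 ≤ N := normC1_nonneg Ω T w
  have ha1 : 0 ≤ a1 := integral_nonneg fun x => sq_nonneg _
  have hg1 : 0 ≤ g1 := integral_nonneg fun x => sq_nonneg _
  have hb0 : 0 ≤ b0 := integral_nonneg fun x => sq_nonneg _
  have he0 : ∫ x in Ω, (‖cylGrad Ω T w (x, 0)‖ ^ 2 + cylDeriv Ω T w (x, 0) (0, 1) ^ 2)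
      = g1 + a1 :=
    integral_add (integrableOn_slice hb (g := fun z => ‖cylGrad Ω T w z‖ ^ 2) (hcG.norm.pow 2) h0)
      (integrableOn_slice hb (g := fun z => cylDeriv Ω T w z (0, 1) ^ 2) (hc1.pow 2) h0)
  rw [he0] at hest
  have hβr : 0 ≤ β.toReal := ENNReal.toReal_nonneg
  have hρr : 0 ≤ ρ.toReal := ENNReal.toReal_nonneg
  -- The Gronwall rate `4 √T` is absorbed by `M · 2√T / Cpw²` through `hM2`.
  have hrate : (1 + C + 4 * Real.sqrt T) * T ≤ T * (M * (1 + C + 2 * Real.sqrt T / Cpw ^ 2)) := by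
    rw [mul_comm _ T]
    refine mul_le_mul_of_nonneg_left ?_ hT.le
    have h1 : M * (1 + C + 2 * Real.sqrt T / Cpw ^ 2)
        = M * (1 + C) + M * (2 / Cpw ^ 2) * Real.sqrt T := by ring
    rw [h1]
    have h2 : 1 + C ≤ M * (1 + C) := le_mul_of_one_le_left (by linarith) hM1
    have h3 := mul_le_mul_of_nonneg_right hM2 (Real.sqrt_nonneg T)
    linarith
  refine (ENNReal.ofReal_le_ofReal hest).trans ?_
  rw [ENNReal.ofReal_mul (by positivity), ENNReal.ofReal_mul (by positivity)]
  gcongr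
  · rw [ENNReal.ofReal_add (by positivity) (by positivity),
      ENNReal.ofReal_add (by positivity) (by positivity),
      ENNReal.ofReal_add (by positivity) (by positivity), ENNReal.ofReal_add hg1 ha1,
      ENNReal.ofReal_toReal hR, ENNReal.ofReal_mul (by norm_num), ENNReal.ofReal_mul hN,
      ENNReal.ofReal_toReal hβ, mul_add]
    refine add_le_add ?_ ?_
    · have hM1' : 1 ≤ ENNReal.ofReal M := by
        rw [ENNReal.one_le_ofReal]
        exact hM1
      refine le_trans ?_ (le_mul_of_one_le_left zero_le hM1')
      have h4 : ENNReal.ofReal 2 * (ENNReal.ofReal N * β) ≤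
          2 * (ENNReal.ofReal T * surfaceMeasure Ω univ) ^ (1 / 2 : ℝ) * ENNReal.ofReal N
            * eLpNorm (fun z => cylDeriv Ω T w z (0, 1)) 2
              ((surfaceMeasure Ω).prod (volume.restrict (Icc 0 T))) := by
        rw [ENNReal.ofReal_ofNat]
        calc 2 * (ENNReal.ofReal N * β) ≤ 2 * (ENNReal.ofReal N *
                ((ENNReal.ofReal T * surfaceMeasure Ω univ) ^ (1 / 2 : ℝ)
                  * eLpNorm (fun z => cylDeriv Ω T w z (0, 1)) 2
                    ((surfaceMeasure Ω).prod (volume.restrict (Icc 0 T))))) := by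
              gcongr
          _ = _ := by ring
      calc _ = ENNReal.ofReal a1 + ρ + ENNReal.ofReal g1
            + ENNReal.ofReal 2 * (ENNReal.ofReal N * β) := by ring
        _ ≤ _ := by gcongr
    -- The initial term `2 b0` is absorbed by the same inequality `hM2`, with room to spare.
    · have h5 : ENNReal.ofReal 2 ≤ ENNReal.ofReal M * ENNReal.ofReal (2 / Cpw ^ 2) := by
        rw [← ENNReal.ofReal_mul (by positivity)]
        exact ENNReal.ofReal_le_ofReal (by linarith)
      rw [ENNReal.ofReal_mul (by norm_num : (0 : ℝ) ≤ 2), ← mul_assoc]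
      gcongr

end

end WavePINN

open WavePINN in
theorem mainTheorem3 {d : ℕ} (hd : 1 ≤ d) (T : ℝ) (hT : 0 < T)
    (Ω : Set (EuclideanSpace ℝ (Fin d))) (hΩ : IsLipschitzDomain Ω)
    (hbdd : Bornology.IsBounded Ω)
    (Cpw : ℝ) (hCpw : IsPoincareWirtingerConst Ω Cpw)
    (a : EuclideanSpace ℝ (Fin d) → ℝ) (ha : AssumptionA1 Ω a)
    (f : EuclideanSpace ℝ (Fin d) × ℝ → ℝ) (k : ℕ) (c r : ℝ) (hf : AssumptionA2 Ω f k c r)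
    (u₀ u₁ : EuclideanSpace ℝ (Fin d) → ℝ) (u : EuclideanSpace ℝ (Fin d) × ℝ → ℝ)
    (hu : IsClassicalSolution Ω T a f u₀ u₁ u)
    (σ : ℝ → ℝ) (hσ : Differentiable ℝ σ ∧ Differentiable ℝ (deriv σ))
    (L w : ℕ) (R : ENNReal) (hR : 0 < R)
    (θ : NeuralNet (d + 1) 1) (hθ : θ ∈ parameterSpace L w R (d + 1) 1)
    (hθ2 : ContDiffOn ℝ 2 (pinn σ θ) (cylinder (closure Ω) T)) :
    (∫⁻ z in cylinder Ω T, ‖pinn σ θ z - u z‖ₑ ^ 2)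
        + (∫⁻ z in cylinder Ω T, ‖timeDeriv T (pinn σ θ) z - timeDeriv T u z‖ₑ ^ 2) ≤
      ENNReal.ofReal (max 1 (2 * Cpw ^ 2)) *
        (eLpNorm (residualU1 T u₁ (pinn σ θ)) 2 (volume.restrict Ω) ^ 2
          + eLpNorm (residualPDE T a f (pinn σ θ)) 2 (volume.restrict (cylinder Ω T)) ^ 2
          + eLpNorm (residualGrad u₀ (pinn σ θ)) 2 (volume.restrict Ω) ^ 2
          + 2 * (ENNReal.ofReal T * surfaceMeasure Ω univ) ^ (1 / 2 : ℝ)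
              * ENNReal.ofReal (normC1 Ω T (pinn σ θ - u))
              * eLpNorm (residualBdryUt T (pinn σ θ)) 2
                  ((surfaceMeasure Ω).prod (volume.restrict (Icc 0 T)))
          + ENNReal.ofReal (2 / Cpw ^ 2)
              * eLpNorm (residualU0 u₀ (pinn σ θ)) 2 (volume.restrict Ω) ^ 2) *
        ENNReal.ofReal T *
        ENNReal.ofReal (Real.exp (T * (max 1 (2 * Cpw ^ 2) *
          (1 + nonlinearityConst Ω T c r u (pinn σ θ - u) + 2 * Real.sqrt T / Cpw ^ 2)))) :=
  lintegral_error_le hΩ hbdd hT hCpw.1 ha hf hθ2 hu
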